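/- Let $d\ge 2$, $h\ge 0$ and $\gamma\in\mathbb R$; in (i) and (ii) assume moreover $h>0$. Let $\bar{\mathbb B}$ and $\mathbb S$ be the closed unit ball and the unit sphere of $\mathbb R^d$, and let $\sigma_{d-1}$ be the normalized surface measure of $\mathbb S$. Put $k(x,t)=|x-t|^{-(d-2)}$ if $d\ge3$ and $k(x,t)=\log\frac1{|x-t|}$ if $d=2$ (with $k(x,x)=+\infty$), and $$Q(x)=\frac{\gamma}{(|x|^2+h^2)^{d/2-1}}\ \text{ if } d\ge 3,\qquad Q(x)=\frac{\gamma}{2}\log\frac1{|x|^2+h^2}\ \text{ if } d=2$$ (if $h=0$, then $Q(0)=+\infty$ for $\gamma>0$ and $Q(0)=0$ for $\gamma=0$). The equilibrium measure $\mu_{Q,\mathbb B}$ is the minimizer of $$I_Q(\mu)=\iint k(x,t)\,d\mu(x)\,d\mu(t)+2\int Q\,d\mu$$ among all Borel probability measures $\mu$ on $\bar{\mathbb B}$. Let $\tilde\gamma=-(1+h^2)^{d/2}$, let $R=R_0:=h/\sqrt{|\gamma|^{2/d}-1}$ if $\gamma<\tilde\gamma$ and $R=1$ if $\tilde\gamma\le\gamma<0$.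 For $\gamma<0$ let $\tau$ be the measure given in polar coordinates $x=r\omega$, $\omega\in\mathbb S$, by $$d\tau(x)=-d\,\gamma h^2\,\frac{r^{d-1}}{(r^2+h^2)^{1+d/2}}\,dr\,d\sigma_{d-1}(\omega),\qquad 0\le r\le R.$$ Then $\mu_{Q,\mathbb B}$ exists, is unique, and is given as follows. (i) If $\gamma\le\tilde\gamma$, then $R\le 1$ and $\mu_{Q,\mathbb B}=\tau$. (ii) If $\tilde\gamma<\gamma<0$, then $R=1$ and $\mu_{Q,\mathbb B}=\tau+(1-\gamma/\tilde\gamma)\,\sigma_{d-1}$. (iii) If $\gamma\ge 0$, then $\mu_{Q,\mathbb B}=\sigma_{d-1}$. -/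

import Mathlib

open MeasureTheory Set Metric

noncomputable section

namespace CoulombBall

/-- Extended-real integral: integral of the positive part minus integral of the negative part.
For functions bounded below on the support of a finite measure this is the usual integral,
with value in `(-∞, +∞]`. -/
def eintegral {X : Type*} [MeasurableSpace X] (μ : Measure X) (f : X → EReal) : EReal :=
  ((∫⁻ x, (f x).toENNReal ∂μ : ENNReal) : EReal) - ((∫⁻ x, (-f x).toENNReal ∂μ : ENNReal) : EReal)

/-- The Coulomb kernel of `ℝ^d` (`d ≥ 2`) as a function of the distance `r ≥ 0`:
`log (1 / r)` for `d = 2`, and `1 / r ^ (d - 2)` for `d ≥ 3`; it equals `+∞` at `r = 0`. -/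
def kernel (d : ℕ) (r : ℝ) : EReal :=
  if r = 0 then ⊤
  else if d = 2 then ((Real.log (1 / r) : ℝ) : EReal)
  else ((1 / r ^ (d - 2) : ℝ) : EReal)

/-- The external field created on `ℝ^d` by a charge `γ` placed at height `h` above the origin.
At the location of the charge (`x = 0` when `h = 0`) its value is `γ · (+∞)`. -/
def externalField (d : ℕ) (γ h : ℝ) (x : EuclideanSpace ℝ (Fin d)) : EReal :=
  if ‖x‖ ^ 2 + h ^ 2 = 0 then (γ : EReal) * ⊤
  else if d = 2 then ((γ / 2 * Real.log (1 / (‖x‖ ^ 2 + h ^ 2)) : ℝ) : EReal)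
  else ((γ / (‖x‖ ^ 2 + h ^ 2) ^ ((d : ℝ) / 2 - 1) : ℝ) : EReal)

/-- The energy `I(μ)`: the double integral of the kernel. -/
def energy (d : ℕ) (μ : Measure (EuclideanSpace ℝ (Fin d))) : EReal :=
  eintegral (μ.prod μ) fun p => kernel d ‖p.1 - p.2‖

/-- The weighted energy `I_Q(μ) = I(μ) + 2 ∫ Q dμ`. -/
def weightedEnergy (d : ℕ) (Q : EuclideanSpace ℝ (Fin d) → EReal)
    (μ : Measure (EuclideanSpace ℝ (Fin d))) : EReal :=
  energy d μ + 2 * eintegral μ Q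

/-- `μ` minimizes `I_Q` among the Borel probability measures carried by `K`. -/
def IsEquilibriumMeasure (d : ℕ) (K : Set (EuclideanSpace ℝ (Fin d)))
    (Q : EuclideanSpace ℝ (Fin d) → EReal) (μ : Measure (EuclideanSpace ℝ (Fin d))) : Prop :=
  IsProbabilityMeasure μ ∧ μ Kᶜ = 0 ∧
    ∀ ν : Measure (EuclideanSpace ℝ (Fin d)), IsProbabilityMeasure ν → ν Kᶜ = 0 →
      weightedEnergy d Q μ ≤ weightedEnergy d Q ν

/-- The normalized surface measure `σ_{d-1}`, on the unit sphere as a space in itself. -/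
def sphereProb (d : ℕ) : Measure (sphere (0 : EuclideanSpace ℝ (Fin d)) 1) :=
  ((volume : Measure (EuclideanSpace ℝ (Fin d))).toSphere univ)⁻¹ •
    (volume : Measure (EuclideanSpace ℝ (Fin d))).toSphere

/-- The normalized surface measure `σ_{d-1}`, as a measure on `ℝ^d`. -/
def sigma (d : ℕ) : Measure (EuclideanSpace ℝ (Fin d)) :=
  (sphereProb d).map Subtype.val

/-- The critical charge. -/
def gammaTilde (d : ℕ) (h : ℝ) : ℝ := -(1 + h ^ 2) ^ ((d : ℝ) / 2)

/-- The radius `R_0` (used for `γ < -1`). -/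
def radiusZero (d : ℕ) (γ h : ℝ) : ℝ := h / Real.sqrt (|γ| ^ (2 / (d : ℝ)) - 1)

open Classical in
/-- The radius `R` (used for `γ < 0`). -/
def radius (d : ℕ) (γ h : ℝ) : ℝ := if γ < gammaTilde d h then radiusZero d γ h else 1

/-- The measure
`dτ = - d γ h² r^(d-1) / (r² + h²)^(1 + d/2) dr dσ_{d-1}`, `0 ≤ r ≤ R`, for `γ < 0`: the image
under the polar map `(r, ω) ↦ r ω`. -/
def tau (d : ℕ) (γ h : ℝ) : Measure (EuclideanSpace ℝ (Fin d)) :=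
  ((((volume : Measure ℝ).restrict (Icc 0 (radius d γ h))).withDensity fun r =>
      ENNReal.ofReal (-(d * γ * h ^ 2) * (r ^ (d - 1) / (r ^ 2 + h ^ 2) ^ (1 + (d : ℝ) / 2)))).prod
    (sphereProb d)).map fun p => p.1 • (p.2 : EuclideanSpace ℝ (Fin d))

end CoulombBall

end

/-!
Write `p = d / 2`. On distances at most `2`, the diameter of the ball, the Coulomb kernel is an
affine function, with positive slope, of `coulomb p s = ∫ v in (s, 4], v ^ (-p)`, where `s` is the
squared distance (`kernel_eq`). This form does not distinguish `d = 2` from `d ≥ 3`, and it is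
nonnegative, so that energies and potentials are Lebesgue integrals with values in `[0, ∞]` and
Tonelli's theorem applies without integrability conditions.

*Uniqueness and minimality.* The kernel is a mixture of Gaussians,
`coulomb p s = Γ(p)⁻¹ ∫ t ^ (p - 2) (exp (-t s) - exp (-4 t)) dt`, and for a Gaussian kernel the
energy of `μ - ν` is, by Fourier transform, the integral of `|μ̂ - ν̂|²` against a Gaussian
(`gaussianEnergy_diff`). Hence `2 E(μ, ν) ≤ E(μ, μ) + E(ν, ν)`, with equality only for `μ = ν` when
`E(μ, ν)` is finite. It follows (`frostman`) that a probability measure `μ` is the only minimizer as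
soon as its potential plus the external field is at least some constant on the ball and equal to
it `μ`-almost everywhere.

*Potentials.* Newton's theorem (`lintegral_coulomb_sphere`) says that the uniform measure on the
sphere of radius `r` has the potential of a point mass at the centre outside the sphere and a
constant potential inside. Its core is that the flux of the field of an exterior charge through a
sphere vanishes (`integral_flux_eq_zero`): this flux does not depend on the radius of the sphere,
by the divergence theorem on the sphere, which is the infinitesimal form of rotation invariance.
Consequently a radial measure whose mass in the ball of radius `√v` is `m(v)` has at `x` the
potential `∫ v in (|x|², 4], v ^ (-p) m(v)`.

*The balance.* The density of `τ` has mass `m(v) = -γ (v / (v + h²)) ^ p` inside radius `√v`, so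
`v ^ (-p) m(v) = -γ (v + h²) ^ (-p)`, which is minus the derivative of the negated external field as
a function of `v = |x|²`, in the units of `coulomb`. So `τ` balances the field inside radius `R`.
If `m` reaches the value `1` at a radius `R ≤ 1`, nothing is left to place, and beyond `R`
the unbalanced part of the field only raises the total potential (`massDefect`). Otherwise `R = 1`,
and the missing mass goes to the unit sphere, where its potential is constant on the ball. For
`γ ≥ 0` the uniform measure on the unit sphere minimizes the energy and the external field at the
same time.
-/

namespace CoulombBall

/-! ### Gaussian kernels are strictly positive definite -/

section Gaussian

variable {V : Type*} [NormedAddCommGroup V] [InnerProductSpace ℝ V] [MeasurableSpace V]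

/-- The mutual energy of `μ` and `ν` for the Gaussian kernel `exp (-t |x - y|²)`. -/
noncomputable def gaussianEnergy (t : ℝ) (μ ν : Measure V) : ℝ :=
  ∫ z, Real.exp (-t * ‖z.1 - z.2‖ ^ 2) ∂(μ.prod ν)

lemma charFun_mul_conj_charFun (μ ν : Measure V) [IsProbabilityMeasure μ] [IsProbabilityMeasure ν]
    (ξ : V) :
    charFun μ ξ * (starRingEnd ℂ) (charFun ν ξ) =
      ∫ z, Complex.exp (Complex.I * (inner ℝ (z.1 - z.2) ξ : ℝ)) ∂(μ.prod ν) := by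
  rw [← charFun_neg, charFun_apply, charFun_apply, ← integral_prod_mul]
  congr 1
  ext z
  rw [← Complex.exp_add, inner_sub_left, inner_neg_right]
  congr 1
  push_cast
  ring

variable [FiniteDimensional ℝ V] [BorelSpace V]

/-- The Gaussian energy in Fourier space: up to a positive constant it is the integral of
`μ̂ · conj ν̂` against a Gaussian. -/
lemma integral_gaussian_mul_charFun {t : ℝ} (ht : 0 < t) (μ ν : Measure V)
    [IsProbabilityMeasure μ] [IsProbabilityMeasure ν] :
    ∫ ξ, Complex.exp (-((1 / (4 * t) : ℝ) : ℂ) * ‖ξ‖ ^ 2) *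
        (charFun μ ξ * (starRingEnd ℂ) (charFun ν ξ)) =
      (((Real.pi * (4 * t)) ^ (Module.finrank ℝ V / 2 : ℝ) * gaussianEnergy t μ ν : ℝ) : ℂ) := by
  set b : ℝ := 1 / (4 * t) with hb
  have hb0 : 0 < b := by positivity
  have hb0' : 0 < (b : ℂ).re := by simpa using hb0
  have hint : Integrable (fun ξ : V ↦ Complex.exp (-(b : ℂ) * ‖ξ‖ ^ 2)) := by
    simpa using GaussianFourier.integrable_cexp_neg_mul_sq_norm_add hb0' 0 (0 : V)
  simp_rw [charFun_mul_conj_charFun, ← integral_const_mul]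
  rw [integral_integral_swap]
  · rw [gaussianEnergy, ← integral_const_mul, ← integral_complex_ofReal]
    congr 1
    ext z
    have h := GaussianFourier.integral_cexp_neg_mul_sq_norm_add hb0' Complex.I (z.1 - z.2)
    simp_rw [Complex.exp_add] at h
    rw [h]
    have hpb : (Real.pi / b : ℝ) = Real.pi * (4 * t) := by rw [hb]; field_simp
    push_cast
    rw [Complex.ofReal_cpow (by positivity)]
    congr 1
    · rw [← hpb]
      push_cast
      rfl
    · rw [hb]
      push_cast
      congr 1
      have : (t : ℂ) ≠ 0 := by exact_mod_cast ht.ne'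
      rw [Complex.I_sq]
      field_simp
  · refine Integrable.mono' (g := fun w : V × (V × V) ↦ ‖Complex.exp (-(b : ℂ) * ‖w.1‖ ^ 2)‖)
      (hint.norm.comp_fst _) ?_ ?_
    · apply Continuous.aestronglyMeasurable
      simp only [Function.uncurry_def]
      fun_prop
    · filter_upwards with w
      simp only [Function.uncurry_def, norm_mul]
      rw [mul_comm Complex.I, Complex.norm_exp_ofReal_mul_I, mul_one]

/-- The Gaussian energy of the signed measure `μ - ν` in Fourier space. -/
lemma gaussianEnergy_diff {t : ℝ} (ht : 0 < t) (μ ν : Measure V)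
    [IsProbabilityMeasure μ] [IsProbabilityMeasure ν] :
    ∫ ξ, Real.exp (-(1 / (4 * t)) * ‖ξ‖ ^ 2) * ‖charFun μ ξ - charFun ν ξ‖ ^ 2 =
      (Real.pi * (4 * t)) ^ (Module.finrank ℝ V / 2 : ℝ) *
        (gaussianEnergy t μ μ + gaussianEnergy t ν ν - 2 * gaussianEnergy t μ ν) := by
  have hsymm : gaussianEnergy t ν μ = gaussianEnergy t μ ν := by
    unfold gaussianEnergy
    rw [← integral_prod_swap]
    simp [norm_sub_rev]
  have hint : ∀ μ ν : Measure V, IsProbabilityMeasure μ → IsProbabilityMeasure ν →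
      Integrable (fun ξ : V ↦ Complex.exp (-((1 / (4 * t) : ℝ) : ℂ) * ‖ξ‖ ^ 2) *
        (charFun μ ξ * (starRingEnd ℂ) (charFun ν ξ))) := by
    intro μ ν _ _
    have hb0' : 0 < (((1 / (4 * t) : ℝ) : ℂ)).re := by
      rw [Complex.ofReal_re]; positivity
    have h0 : Integrable (fun ξ : V ↦ Complex.exp (-((1 / (4 * t) : ℝ) : ℂ) * ‖ξ‖ ^ 2)) := by
      simpa using GaussianFourier.integrable_cexp_neg_mul_sq_norm_add hb0' 0 (0 : V)
    refine h0.mul_bdd (c := 1) ?_ ?_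
    · exact (measurable_charFun.mul
        (Complex.continuous_conj.measurable.comp measurable_charFun)).aestronglyMeasurable
    · filter_upwards with ξ
      rw [norm_mul, RCLike.norm_conj]
      exact mul_le_one₀ (norm_charFun_le_one ξ) (norm_nonneg _) (norm_charFun_le_one ξ)
  apply Complex.ofReal_injective
  rw [← integral_complex_ofReal]
  have hpt : ∀ ξ : V, ((Real.exp (-(1 / (4 * t)) * ‖ξ‖ ^ 2) *
      ‖charFun μ ξ - charFun ν ξ‖ ^ 2 : ℝ) : ℂ) =
      (Complex.exp (-((1 / (4 * t) : ℝ) : ℂ) * ‖ξ‖ ^ 2) *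
        (charFun μ ξ * (starRingEnd ℂ) (charFun μ ξ)) +
      Complex.exp (-((1 / (4 * t) : ℝ) : ℂ) * ‖ξ‖ ^ 2) *
        (charFun ν ξ * (starRingEnd ℂ) (charFun ν ξ))) -
      (Complex.exp (-((1 / (4 * t) : ℝ) : ℂ) * ‖ξ‖ ^ 2) *
        (charFun μ ξ * (starRingEnd ℂ) (charFun ν ξ)) +
      Complex.exp (-((1 / (4 * t) : ℝ) : ℂ) * ‖ξ‖ ^ 2) *
        (charFun ν ξ * (starRingEnd ℂ) (charFun μ ξ))) := by
    intro ξ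
    have h := Complex.mul_conj' (charFun μ ξ - charFun ν ξ)
    push_cast
    rw [← h, map_sub]
    ring
  simp_rw [hpt]
  have h1 := hint μ μ ‹_› ‹_›
  have h2 := hint ν ν ‹_› ‹_›
  have h3 := hint μ ν ‹_› ‹_›
  have h4 := hint ν μ ‹_› ‹_›
  rw [integral_sub (by exact h1.add h2) (by exact h3.add h4), integral_add h1 h2,
    integral_add h3 h4,
    integral_gaussian_mul_charFun ht, integral_gaussian_mul_charFun ht,
    integral_gaussian_mul_charFun ht, integral_gaussian_mul_charFun ht, hsymm]
  push_cast
  ring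

lemma two_mul_gaussianEnergy_le {t : ℝ} (ht : 0 < t) (μ ν : Measure V)
    [IsProbabilityMeasure μ] [IsProbabilityMeasure ν] :
    2 * gaussianEnergy t μ ν ≤ gaussianEnergy t μ μ + gaussianEnergy t ν ν := by
  have h := gaussianEnergy_diff ht μ ν
  have h0 : 0 ≤ ∫ ξ, Real.exp (-(1 / (4 * t)) * ‖ξ‖ ^ 2) * ‖charFun μ ξ - charFun ν ξ‖ ^ 2 :=
    integral_nonneg fun ξ ↦ by positivity
  rw [h] at h0
  have := nonneg_of_mul_nonneg_right h0 (by positivity)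
  linarith

/-- Strict positive definiteness of the Gaussian kernel: the characteristic functions agree almost
everywhere, hence everywhere by continuity. -/
lemma eq_of_two_mul_gaussianEnergy_eq {t : ℝ} (ht : 0 < t) (μ ν : Measure V)
    [IsProbabilityMeasure μ] [IsProbabilityMeasure ν]
    (h : gaussianEnergy t μ μ + gaussianEnergy t ν ν = 2 * gaussianEnergy t μ ν) : μ = ν := by
  have h0 := gaussianEnergy_diff ht μ ν
  rw [h, sub_self, mul_zero] at h0
  have hc : Continuous fun ξ : V ↦
      Real.exp (-(1 / (4 * t)) * ‖ξ‖ ^ 2) * ‖charFun μ ξ - charFun ν ξ‖ ^ 2 := by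
    have h1 : Continuous (charFun μ) := continuous_charFun
    have h2 : Continuous (charFun ν) := continuous_charFun
    fun_prop
  have hint : Integrable fun ξ : V ↦
      Real.exp (-(1 / (4 * t)) * ‖ξ‖ ^ 2) * ‖charFun μ ξ - charFun ν ξ‖ ^ 2 := by
    have hb0' : 0 < (((1 / (4 * t) : ℝ) : ℂ)).re := by
      rw [Complex.ofReal_re]; positivity
    have h0 := (GaussianFourier.integrable_cexp_neg_mul_sq_norm_add hb0' 0 (0 : V)).norm.const_mul 4
    refine h0.mono' hc.aestronglyMeasurable ?_
    filter_upwards with ξ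
    rw [Real.norm_of_nonneg (by positivity), mul_comm]
    have h3 : ‖charFun μ ξ - charFun ν ξ‖ ≤ 2 := by
      have := norm_sub_le (charFun μ ξ) (charFun ν ξ)
      have h1 := norm_charFun_le_one (μ := μ) ξ
      have h2 := norm_charFun_le_one (μ := ν) ξ
      linarith
    have h4 : ‖charFun μ ξ - charFun ν ξ‖ ^ 2 ≤ 4 := by
      nlinarith [norm_nonneg (charFun μ ξ - charFun ν ξ)]
    have h5 : ‖Complex.exp (-((1 / (4 * t) : ℝ) : ℂ) * ‖ξ‖ ^ 2 + 0 * (inner ℝ (0 : V) ξ : ℝ))‖ =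
        Real.exp (-(1 / (4 * t)) * ‖ξ‖ ^ 2) := by
      rw [zero_mul, add_zero, Complex.norm_exp]
      congr 1
      rw [← Complex.ofReal_pow, ← Complex.ofReal_neg, ← Complex.ofReal_mul, Complex.ofReal_re]
    rw [h5]
    gcongr
  have hae := (integral_eq_zero_iff_of_nonneg (fun ξ ↦ by positivity) hint).1 h0
  have heq := (Continuous.ae_eq_iff_eq volume hc continuous_zero).1 hae
  refine Measure.ext_of_charFun (funext fun ξ ↦ ?_)
  have := congrFun heq ξ
  simpa [Real.exp_ne_zero, sub_eq_zero] using this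

end Gaussian

/-! ### The Coulomb kernel as a mixture of Gaussians, and its positive definiteness -/

section PositiveDefinite

/-- The Coulomb kernel as a function of the squared distance `s`, normalized to vanish at distance
`2`, the diameter of the unit ball. For `p = d / 2` it is a positive multiple of the kernel of `ℝ^d`
up to an additive constant, and the normalization makes it nonnegative on the ball. -/
noncomputable def coulomb (p s : ℝ) : ENNReal := ∫⁻ v in Ioc s 4, ENNReal.ofReal (v ^ (-p))

lemma coulomb_anti (p : ℝ) : Antitone (coulomb p) := fun _ _ h ↦
  lintegral_mono_set (Ioc_subset_Ioc_left h)

@[fun_prop]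
lemma measurable_coulomb (p : ℝ) : Measurable (coulomb p) := (coulomb_anti p).measurable

lemma ofReal_rpow_neg_eq_lintegral {p v : ℝ} (hp : 0 < p) (hv : 0 < v) :
    ENNReal.ofReal (v ^ (-p)) =
      ∫⁻ t in Ioi (0 : ℝ), ENNReal.ofReal (t ^ (p - 2) / Real.Gamma p) *
        ENNReal.ofReal (t * Real.exp (-(v * t))) := by
  have hG := Real.Gamma_pos_of_pos hp
  have h := Real.integral_rpow_mul_exp_neg_mul_Ioi hp hv
  have hI : IntegrableOn (fun t : ℝ ↦ t ^ (p - 1) * Real.exp (-(v * t))) (Ioi 0) := by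
    by_contra hcon
    rw [integral_undef hcon] at h
    have : 0 < (1 / v) ^ p * Real.Gamma p := by positivity
    exact this.ne h
  have h1 : ∀ t ∈ Ioi (0 : ℝ), ENNReal.ofReal (t ^ (p - 2) / Real.Gamma p) *
        ENNReal.ofReal (t * Real.exp (-(v * t))) =
      ENNReal.ofReal ((t ^ (p - 1) * Real.exp (-(v * t))) / Real.Gamma p) := by
    intro t ht
    have ht : 0 < t := ht
    rw [← ENNReal.ofReal_mul (by positivity)]
    congr 1
    have : t ^ (p - 1) = t ^ (p - 2) * t := by
      rw [← Real.rpow_add_one ht.ne']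
      congr 1
      ring
    rw [this]
    ring
  rw [setLIntegral_congr_fun measurableSet_Ioi h1, ← ofReal_integral_eq_lintegral_ofReal
    (hI.div_const _) ?_, integral_div, h]
  · congr 1
    rw [one_div, Real.inv_rpow hv.le, Real.rpow_neg hv.le]
    field_simp
  · filter_upwards [ae_restrict_mem measurableSet_Ioi] with t ht
    have ht : 0 < t := ht
    simp only [Pi.zero_apply]
    positivity

/-- The Coulomb kernel is a mixture of Gaussian kernels. -/
lemma coulomb_eq_lintegral_gaussian {p s : ℝ} (hp : 0 < p) (hs : 0 ≤ s) (hs4 : s ≤ 4) :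
    coulomb p s = ∫⁻ t in Ioi (0 : ℝ), ENNReal.ofReal (t ^ (p - 2) / Real.Gamma p) *
      ENNReal.ofReal (Real.exp (-t * s) - Real.exp (-4 * t)) := by
  have h1 : coulomb p s = ∫⁻ v in Ioc s 4, ∫⁻ t in Ioi (0 : ℝ),
      ENNReal.ofReal (t ^ (p - 2) / Real.Gamma p) *
        ENNReal.ofReal (t * Real.exp (-(v * t))) :=
    setLIntegral_congr_fun measurableSet_Ioc fun v hv ↦
      ofReal_rpow_neg_eq_lintegral hp (hs.trans_lt hv.1)
  rw [h1, lintegral_lintegral_swap]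
  · refine setLIntegral_congr_fun measurableSet_Ioi fun t ht ↦ ?_
    have ht : 0 < t := ht
    rw [lintegral_const_mul _ (by fun_prop)]
    congr 1
    have hc : Continuous fun v : ℝ ↦ t * Real.exp (-(v * t)) := by fun_prop
    rw [← ofReal_integral_eq_lintegral_ofReal
      ((hc.integrableOn_Icc (a := s) (b := 4)).mono_set Ioc_subset_Icc_self),
      ← intervalIntegral.integral_of_le hs4]
    · congr 1
      have hd : ∀ v ∈ uIcc s 4, HasDerivAt (fun v : ℝ ↦ -Real.exp (-(v * t)))
          (t * Real.exp (-(v * t))) v := by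
        intro v _
        have := ((hasDerivAt_mul_const t (x := v)).fun_neg.exp).fun_neg
        convert! this using 1
        ring
      rw [intervalIntegral.integral_eq_sub_of_hasDerivAt hd (hc.intervalIntegrable _ _),
        show -t * s = -(s * t) by ring, show -4 * t = -(4 * t) by ring]
      ring
    · filter_upwards with v
      simp only [Pi.zero_apply]
      positivity
  · apply Measurable.aemeasurable
    simp only [Function.uncurry_def]
    fun_prop

variable {V : Type*} [NormedAddCommGroup V] [MeasurableSpace V]

/-- The mutual Coulomb energy of `μ` and `ν`. -/
noncomputable def coulombEnergy (p : ℝ) (μ ν : Measure V) : ENNReal :=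
  ∫⁻ z, coulomb p (‖z.1 - z.2‖ ^ 2) ∂(μ.prod ν)

lemma ae_prod_norm_sub_sq_le {μ ν : Measure V} [SFinite μ] [SFinite ν]
    (hμ : μ (closedBall 0 1)ᶜ = 0) (hν : ν (closedBall 0 1)ᶜ = 0) :
    ∀ᵐ z ∂(μ.prod ν), ‖z.1 - z.2‖ ^ 2 ≤ 4 := by
  have hμ' : ∀ᵐ x ∂μ, x ∈ closedBall (0 : V) 1 := hμ
  have hν' : ∀ᵐ x ∂ν, x ∈ closedBall (0 : V) 1 := hν
  have h1 : ∀ᵐ z ∂(μ.prod ν), z.1 ∈ closedBall (0 : V) 1 :=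
    Measure.quasiMeasurePreserving_fst.ae hμ'
  have h2 : ∀ᵐ z ∂(μ.prod ν), z.2 ∈ closedBall (0 : V) 1 :=
    Measure.quasiMeasurePreserving_snd.ae hν'
  filter_upwards [h1, h2] with z hz1 hz2
  rw [mem_closedBall_zero_iff] at hz1 hz2
  have := norm_sub_le z.1 z.2
  nlinarith [norm_nonneg (z.1 - z.2)]

variable [InnerProductSpace ℝ V] [FiniteDimensional ℝ V] [BorelSpace V]

lemma integrable_gaussian {t : ℝ} (ht : 0 < t) {μ ν : Measure V}
    [IsProbabilityMeasure μ] [IsProbabilityMeasure ν] :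
    Integrable (fun z : V × V ↦ Real.exp (-t * ‖z.1 - z.2‖ ^ 2)) (μ.prod ν) := by
  refine (integrable_const (1 : ℝ)).mono' (by fun_prop) ?_
  filter_upwards with z
  rw [Real.norm_of_nonneg (Real.exp_pos _).le, Real.exp_le_one_iff]
  have : 0 ≤ t * ‖z.1 - z.2‖ ^ 2 := by positivity
  linarith

lemma coulombEnergy_eq_lintegral_gaussianEnergy {p : ℝ} (hp : 0 < p) {μ ν : Measure V}
    [IsProbabilityMeasure μ] [IsProbabilityMeasure ν]
    (hμ : μ (closedBall 0 1)ᶜ = 0) (hν : ν (closedBall 0 1)ᶜ = 0) :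
    coulombEnergy p μ ν = ∫⁻ t in Ioi (0 : ℝ), ENNReal.ofReal (t ^ (p - 2) / Real.Gamma p) *
      ENNReal.ofReal (gaussianEnergy t μ ν - Real.exp (-4 * t)) := by
  have hae := ae_prod_norm_sub_sq_le hμ hν
  have h1 : coulombEnergy p μ ν = ∫⁻ z, (∫⁻ t in Ioi (0 : ℝ),
      ENNReal.ofReal (t ^ (p - 2) / Real.Gamma p) *
      ENNReal.ofReal (Real.exp (-t * ‖z.1 - z.2‖ ^ 2) - Real.exp (-4 * t))) ∂(μ.prod ν) := by
    refine lintegral_congr_ae ?_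
    filter_upwards [hae] with z hz
    exact coulomb_eq_lintegral_gaussian hp (by positivity) hz
  rw [h1, lintegral_lintegral_swap]
  · refine setLIntegral_congr_fun measurableSet_Ioi fun t ht ↦ ?_
    have ht : 0 < t := ht
    have hi := integrable_gaussian ht (μ := μ) (ν := ν)
    rw [lintegral_const_mul _ (by fun_prop)]
    congr 1
    rw [← ofReal_integral_eq_lintegral_ofReal (by exact hi.sub (integrable_const _)),
      integral_sub hi (integrable_const _)]
    · simp [gaussianEnergy]
    · filter_upwards [hae] with z hz
      simp only [Pi.zero_apply, sub_nonneg, Real.exp_le_exp]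
      nlinarith
  · apply Measurable.aemeasurable
    simp only [Function.uncurry_def]
    fun_prop

lemma exp_le_gaussianEnergy {t : ℝ} (ht : 0 < t) {μ ν : Measure V}
    [IsProbabilityMeasure μ] [IsProbabilityMeasure ν]
    (hμ : μ (closedBall 0 1)ᶜ = 0) (hν : ν (closedBall 0 1)ᶜ = 0) :
    Real.exp (-4 * t) ≤ gaussianEnergy t μ ν := by
  have hi := integrable_gaussian ht (μ := μ) (ν := ν)
  have : ∫ _, Real.exp (-4 * t) ∂(μ.prod ν) = Real.exp (-4 * t) := by simp
  rw [← this]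
  refine integral_mono_ae (integrable_const _) hi ?_
  filter_upwards [ae_prod_norm_sub_sq_le hμ hν] with z hz
  simp only [Real.exp_le_exp]
  nlinarith

lemma measurable_gaussianEnergy (μ ν : Measure V) [IsProbabilityMeasure μ]
    [IsProbabilityMeasure ν] : Measurable fun t ↦ gaussianEnergy t μ ν := by
  refine StronglyMeasurable.measurable ?_
  refine StronglyMeasurable.integral_prod_right (E := ℝ) (f := fun (t : ℝ) (z : V × V) ↦
    Real.exp (-t * ‖z.1 - z.2‖ ^ 2)) ?_
  refine Continuous.stronglyMeasurable ?_
  simp only [Function.uncurry_def]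
  fun_prop

lemma ofReal_gaussianEnergy_le {p t : ℝ} (ht : 0 < t) {μ ν : Measure V}
    [IsProbabilityMeasure μ] [IsProbabilityMeasure ν]
    (hμ : μ (closedBall 0 1)ᶜ = 0) (hν : ν (closedBall 0 1)ᶜ = 0) :
    2 * (ENNReal.ofReal (t ^ (p - 2) / Real.Gamma p) *
        ENNReal.ofReal (gaussianEnergy t μ ν - Real.exp (-4 * t))) ≤
      ENNReal.ofReal (t ^ (p - 2) / Real.Gamma p) *
        ENNReal.ofReal (gaussianEnergy t μ μ - Real.exp (-4 * t)) +
      ENNReal.ofReal (t ^ (p - 2) / Real.Gamma p) *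
        ENNReal.ofReal (gaussianEnergy t ν ν - Real.exp (-4 * t)) := by
  have h1 := exp_le_gaussianEnergy ht hμ hμ
  have h2 := exp_le_gaussianEnergy ht hν hν
  rw [← mul_add, ← ENNReal.ofReal_add (by linarith) (by linarith), mul_left_comm,
    ← ENNReal.ofReal_ofNat 2, ← ENNReal.ofReal_mul (by norm_num)]
  gcongr
  have := two_mul_gaussianEnergy_le ht μ ν
  linarith

/-- Positive definiteness of the Coulomb kernel. -/
lemma two_mul_coulombEnergy_le {p : ℝ} (hp : 0 < p) {μ ν : Measure V}
    [IsProbabilityMeasure μ] [IsProbabilityMeasure ν]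
    (hμ : μ (closedBall 0 1)ᶜ = 0) (hν : ν (closedBall 0 1)ᶜ = 0) :
    2 * coulombEnergy p μ ν ≤ coulombEnergy p μ μ + coulombEnergy p ν ν := by
  have hm := measurable_gaussianEnergy (V := V)
  rw [coulombEnergy_eq_lintegral_gaussianEnergy hp hμ hν,
    coulombEnergy_eq_lintegral_gaussianEnergy hp hμ hμ,
    coulombEnergy_eq_lintegral_gaussianEnergy hp hν hν,
    ← lintegral_const_mul' _ _ (by simp), ← lintegral_add_left (by fun_prop)]
  exact setLIntegral_mono' measurableSet_Ioi fun t ht ↦ ofReal_gaussianEnergy_le ht hμ hν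

/-- Strict positive definiteness of the Coulomb kernel: equality forces equality of the Gaussian
energies for almost every width, and one width is enough. -/
lemma eq_of_two_mul_coulombEnergy_eq {p : ℝ} (hp : 0 < p) {μ ν : Measure V}
    [IsProbabilityMeasure μ] [IsProbabilityMeasure ν]
    (hμ : μ (closedBall 0 1)ᶜ = 0) (hν : ν (closedBall 0 1)ᶜ = 0)
    (hfin : coulombEnergy p μ ν ≠ ⊤)
    (h : coulombEnergy p μ μ + coulombEnergy p ν ν ≤ 2 * coulombEnergy p μ ν) : μ = ν := by
  have hm := measurable_gaussianEnergy (V := V)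
  rw [coulombEnergy_eq_lintegral_gaussianEnergy hp hμ hν] at hfin
  rw [coulombEnergy_eq_lintegral_gaussianEnergy hp hμ hν,
    coulombEnergy_eq_lintegral_gaussianEnergy hp hμ hμ,
    coulombEnergy_eq_lintegral_gaussianEnergy hp hν hν,
    ← lintegral_const_mul' _ _ (by simp), ← lintegral_add_left (by fun_prop)] at h
  have hae := ae_eq_of_ae_le_of_lintegral_le
    ((ae_restrict_mem measurableSet_Ioi).mono fun t ht ↦ ofReal_gaussianEnergy_le ht hμ hν)
    (by rw [lintegral_const_mul' _ _ (by simp)]; exact ENNReal.mul_ne_top (by simp) hfin)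
    (by fun_prop) h
  have : (ae (volume.restrict (Ioi (0 : ℝ)))).NeBot := by
    rw [ae_neBot, Ne, Measure.restrict_eq_zero]
    simp
  obtain ⟨t, ht, heq⟩ := ((ae_restrict_mem measurableSet_Ioi).and hae).exists
  have ht : 0 < t := ht
  have h1 := exp_le_gaussianEnergy ht hμ hμ
  have h2 := exp_le_gaussianEnergy ht hν hν
  have h3 := exp_le_gaussianEnergy ht hμ hν
  refine eq_of_two_mul_gaussianEnergy_eq ht μ ν ?_
  have hG := Real.Gamma_pos_of_pos hp
  beta_reduce at heq
  rw [← mul_add, ← ENNReal.ofReal_add (by linarith) (by linarith), mul_left_comm,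
    ← ENNReal.ofReal_ofNat 2, ← ENNReal.ofReal_mul (by norm_num),
    ENNReal.mul_right_inj (by simpa using by positivity) (by simp),
    ENNReal.ofReal_eq_ofReal_iff (by linarith) (by linarith)] at heq
  linarith

end PositiveDefinite

/-! ### Rotation invariance of the surface measure -/

section Sphere

open scoped Pointwise

variable {d : ℕ}

lemma isProbabilityMeasure_sphereProb (hd : 2 ≤ d) : IsProbabilityMeasure (sphereProb d) := by
  have : NeZero d := ⟨by omega⟩
  have : Nontrivial (EuclideanSpace ℝ (Fin d)) := inferInstance
  refine ⟨?_⟩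
  rw [sphereProb, Measure.smul_apply, smul_eq_mul]
  refine ENNReal.inv_mul_cancel ?_ (measure_ne_top _ _)
  rw [Ne, Measure.measure_univ_eq_zero]
  exact Measure.toSphere_ne_zero _

/-- The map of the unit sphere into itself induced by a linear isometry. -/
noncomputable def sphereMap (L : EuclideanSpace ℝ (Fin d) ≃ₗᵢ[ℝ] EuclideanSpace ℝ (Fin d))
    (ω : sphere (0 : EuclideanSpace ℝ (Fin d)) 1) : sphere (0 : EuclideanSpace ℝ (Fin d)) 1 :=
  ⟨L ω, by simp⟩

lemma continuous_sphereMap (L : EuclideanSpace ℝ (Fin d) ≃ₗᵢ[ℝ] EuclideanSpace ℝ (Fin d)) :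
    Continuous (sphereMap L) :=
  (L.continuous.comp continuous_subtype_val).subtype_mk _

lemma measurePreserving_sphereMap
    (L : EuclideanSpace ℝ (Fin d) ≃ₗᵢ[ℝ] EuclideanSpace ℝ (Fin d)) :
    MeasurePreserving (sphereMap L) (sphereProb d) (sphereProb d) := by
  refine ⟨(continuous_sphereMap L).measurable, ?_⟩
  ext s hs
  rw [Measure.map_apply (continuous_sphereMap L).measurable hs]
  simp only [sphereProb, Measure.smul_apply]
  congr 1
  rw [Measure.toSphere_apply' _ hs,
    Measure.toSphere_apply' _ ((continuous_sphereMap L).measurable hs)]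
  congr 1
  have h : Ioo (0 : ℝ) 1 • (Subtype.val '' (sphereMap L ⁻¹' s)) =
      L ⁻¹' (Ioo (0 : ℝ) 1 • (Subtype.val '' s)) := by
    ext x
    simp only [mem_smul, mem_image, mem_preimage]
    constructor
    · rintro ⟨t, ht, _, ⟨ω, hω, rfl⟩, rfl⟩
      exact ⟨t, ht, _, ⟨_, hω, rfl⟩, by simp [sphereMap]⟩
    · rintro ⟨t, ht, _, ⟨ω, hω, rfl⟩, hx⟩
      refine ⟨t, ht, _, ⟨sphereMap L.symm ω, ?_, rfl⟩, ?_⟩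
      · have : sphereMap L (sphereMap L.symm ω) = ω := by
          ext1
          simp [sphereMap]
        rwa [this]
      · apply L.injective
        simp [sphereMap, ← hx]
  rw [h]
  exact L.measurePreserving.measure_preimage_emb L.toHomeomorph.measurableEmbedding _

lemma integral_sphereMap (L : EuclideanSpace ℝ (Fin d) ≃ₗᵢ[ℝ] EuclideanSpace ℝ (Fin d))
    (f : sphere (0 : EuclideanSpace ℝ (Fin d)) 1 → ℝ) :
    ∫ ω, f (sphereMap L ω) ∂(sphereProb d) = ∫ ω, f ω ∂(sphereProb d) := by
  refine (measurePreserving_sphereMap L).integral_comp ?_ f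
  refine ((continuous_sphereMap L).isClosedEmbedding ?_).measurableEmbedding
  intro a b hab
  ext1
  exact L.injective (congrArg Subtype.val hab)

lemma hasDerivAt_integral_of_continuousOn_compact {X : Type*} [TopologicalSpace X] [CompactSpace X]
    [SecondCountableTopology X] [MeasurableSpace X] [OpensMeasurableSpace X]
    {μ : Measure X} [IsFiniteMeasure μ] {F F' : ℝ → X → ℝ} {x₀ ε : ℝ} (hε : 0 < ε)
    (hF : ∀ x ∈ ball x₀ ε, Continuous (F x))
    (hF' : ContinuousOn (fun z : ℝ × X ↦ F' z.1 z.2) (closedBall x₀ ε ×ˢ univ))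
    (h : ∀ x ∈ ball x₀ ε, ∀ ω, HasDerivAt (fun y ↦ F y ω) (F' x ω) x) :
    HasDerivAt (fun x ↦ ∫ ω, F x ω ∂μ) (∫ ω, F' x₀ ω ∂μ) x₀ := by
  obtain ⟨C, hC⟩ := ((isCompact_closedBall x₀ ε).prod isCompact_univ).exists_bound_of_continuousOn
    hF'
  have hb : ball x₀ ε ∈ nhds x₀ := ball_mem_nhds _ hε
  have hx₀ : x₀ ∈ ball x₀ ε := mem_ball_self hε
  have hc : Continuous (F' x₀) := by
    rw [← continuousOn_univ]
    exact hF'.comp (f := fun ω : X ↦ (x₀, ω)) (by fun_prop)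
      fun ω _ ↦ ⟨ball_subset_closedBall hx₀, mem_univ _⟩
  refine (hasDerivAt_integral_of_dominated_loc_of_deriv_le (bound := fun _ ↦ C) hb ?_ ?_
    hc.aestronglyMeasurable ?_ (integrable_const _) ?_).2
  · filter_upwards [hb] with x hx
    exact (hF x hx).aestronglyMeasurable
  · exact (hF x₀ hx₀).integrable_of_hasCompactSupport (HasCompactSupport.of_compactSpace _)
  · filter_upwards with ω x hx
    exact hC (x, ω) ⟨ball_subset_closedBall hx, mem_univ _⟩
  · filter_upwards with ω x hx
    exact h x hx ω

lemma inner_mem_Icc {x e : EuclideanSpace ℝ (Fin d)} (hx : ‖x‖ = 1) (he : ‖e‖ = 1) :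
    inner ℝ x e ∈ Icc (-1 : ℝ) 1 := by
  have := abs_real_inner_le_norm x e
  rw [hx, he, one_mul] at this
  exact abs_le.1 this

/-- Invariance of the surface measure under the rotations of the plane spanned by `e` and `w`, in
infinitesimal form, for the function `⟨ω, w⟩ G(⟨ω, e⟩)`. -/
lemma integral_inner_sq_mul_deriv (hd : 2 ≤ d) {e w : EuclideanSpace ℝ (Fin d)} (he : ‖e‖ = 1)
    (hw : ‖w‖ = 1) (hew : inner ℝ e w = (0 : ℝ)) {G G' : ℝ → ℝ}
    (hG : ∀ a ∈ Icc (-1 : ℝ) 1, HasDerivAt G (G' a) a) (hG' : ContinuousOn G' (Icc (-1) 1)) :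
    ∫ ω, ((inner ℝ (ω : EuclideanSpace ℝ (Fin d)) w : ℝ) ^ 2 *
        G' (inner ℝ (ω : EuclideanSpace ℝ (Fin d)) e) -
      inner ℝ (ω : EuclideanSpace ℝ (Fin d)) e *
        G (inner ℝ (ω : EuclideanSpace ℝ (Fin d)) e)) ∂(sphereProb d) = 0 := by
  have := isProbabilityMeasure_sphereProb hd
  set u : ℝ → EuclideanSpace ℝ (Fin d) := fun φ ↦ Real.cos φ • e + Real.sin φ • w with hu
  set u' : ℝ → EuclideanSpace ℝ (Fin d) := fun φ ↦ -Real.sin φ • e + Real.cos φ • w with hu'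
  have hwe : inner ℝ w e = (0 : ℝ) := by rw [real_inner_comm, hew]
  have hu1 : ∀ φ, ‖u φ‖ = 1 := by
    intro φ
    rw [← sq_eq_sq₀ (norm_nonneg _) zero_le_one, ← real_inner_self_eq_norm_sq]
    simp only [hu, inner_add_left, inner_add_right, real_inner_smul_left, real_inner_smul_right,
      hew, hwe]
    rw [real_inner_self_eq_norm_sq, real_inner_self_eq_norm_sq, he, hw]
    linear_combination Real.sin_sq_add_cos_sq φ
  have hmem : ∀ φ (ω : sphere (0 : EuclideanSpace ℝ (Fin d)) 1),
      inner ℝ (ω : EuclideanSpace ℝ (Fin d)) (u φ) ∈ Icc (-1 : ℝ) 1 := fun φ ω ↦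
    inner_mem_Icc (by simp) (hu1 φ)
  have hGc : ContinuousOn G (Icc (-1) 1) := fun a ha ↦ (hG a ha).continuousAt.continuousWithinAt
  have hcu : Continuous u := by fun_prop
  have hcu' : Continuous u' := by fun_prop
  -- The reflection in the line through `u (φ / 2)` maps the pair `(e, w)` to `(u φ, -u' φ)`, so the
  -- integral below does not depend on `φ`.
  have hconst : ∀ φ, ∫ ω, inner ℝ (ω : EuclideanSpace ℝ (Fin d)) (u' φ) *
      G (inner ℝ (ω : EuclideanSpace ℝ (Fin d)) (u φ)) ∂(sphereProb d) =
      -∫ ω, inner ℝ (ω : EuclideanSpace ℝ (Fin d)) w *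
      G (inner ℝ (ω : EuclideanSpace ℝ (Fin d)) e) ∂(sphereProb d) := by
    intro φ
    rw [← integral_sphereMap ((ℝ ∙ u (φ / 2)).reflection) (fun ω ↦
      inner ℝ (ω : EuclideanSpace ℝ (Fin d)) w * G (inner ℝ (ω : EuclideanSpace ℝ (Fin d)) e)),
      ← integral_neg]
    have hL : ∀ ω, ((sphereMap ((ℝ ∙ u (φ / 2)).reflection) ω :
        sphere (0 : EuclideanSpace ℝ (Fin d)) 1) : EuclideanSpace ℝ (Fin d)) =
        (2 * inner ℝ (u (φ / 2)) (ω : EuclideanSpace ℝ (Fin d)) : ℝ) • u (φ / 2) - ω := by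
      intro ω
      have h := Submodule.reflection_singleton_apply (𝕜 := ℝ) (u (φ / 2))
        (ω : EuclideanSpace ℝ (Fin d))
      rw [hu1] at h
      refine h.trans ?_
      simp [mul_smul, two_smul]
    have hue : inner ℝ (u (φ / 2)) e = Real.cos (φ / 2) := by
      simp only [hu, inner_add_left, real_inner_smul_left, hwe]
      rw [real_inner_self_eq_norm_sq, he]
      ring
    have huw : inner ℝ (u (φ / 2)) w = Real.sin (φ / 2) := by
      simp only [hu, inner_add_left, real_inner_smul_left, hew]
      rw [real_inner_self_eq_norm_sq, hw]
      ring
    have hcos : Real.cos φ = 2 * Real.cos (φ / 2) ^ 2 - 1 := by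
      rw [← Real.cos_two_mul]
      congr 1
      ring
    have hcos' : Real.cos φ = 1 - 2 * Real.sin (φ / 2) ^ 2 := by
      rw [hcos]
      linear_combination 2 * Real.sin_sq_add_cos_sq (φ / 2)
    have hsin : Real.sin φ = 2 * Real.sin (φ / 2) * Real.cos (φ / 2) := by
      rw [← Real.sin_two_mul]
      congr 1
      ring
    congr 1
    ext ω
    have hux : inner ℝ (u (φ / 2)) (ω : EuclideanSpace ℝ (Fin d)) =
        Real.cos (φ / 2) * inner ℝ (ω : EuclideanSpace ℝ (Fin d)) e +
        Real.sin (φ / 2) * inner ℝ (ω : EuclideanSpace ℝ (Fin d)) w := by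
      simp only [hu, inner_add_left, real_inner_smul_left]
      rw [real_inner_comm, real_inner_comm w]
    have h1 : inner ℝ ((sphereMap ((ℝ ∙ u (φ / 2)).reflection) ω :
        sphere (0 : EuclideanSpace ℝ (Fin d)) 1) : EuclideanSpace ℝ (Fin d)) e =
        inner ℝ (ω : EuclideanSpace ℝ (Fin d)) (u φ) := by
      rw [hL, inner_sub_left, real_inner_smul_left, hue, hux]
      simp only [hu, inner_add_right, real_inner_smul_right]
      rw [hcos, hsin]
      ring
    have h2 : inner ℝ ((sphereMap ((ℝ ∙ u (φ / 2)).reflection) ω :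
        sphere (0 : EuclideanSpace ℝ (Fin d)) 1) : EuclideanSpace ℝ (Fin d)) w =
        -inner ℝ (ω : EuclideanSpace ℝ (Fin d)) (u' φ) := by
      rw [hL, inner_sub_left, real_inner_smul_left, huw, hux]
      simp only [hu', inner_add_right, real_inner_smul_right]
      rw [hcos', hsin]
      ring
    rw [h1, h2]
    ring
  have hder : HasDerivAt (fun φ ↦ ∫ ω, inner ℝ (ω : EuclideanSpace ℝ (Fin d)) (u' φ) *
      G (inner ℝ (ω : EuclideanSpace ℝ (Fin d)) (u φ)) ∂(sphereProb d))
      (∫ ω, ((inner ℝ (ω : EuclideanSpace ℝ (Fin d)) (u' 0) : ℝ) ^ 2 *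
        G' (inner ℝ (ω : EuclideanSpace ℝ (Fin d)) (u 0)) -
      inner ℝ (ω : EuclideanSpace ℝ (Fin d)) (u 0) *
        G (inner ℝ (ω : EuclideanSpace ℝ (Fin d)) (u 0))) ∂(sphereProb d)) 0 := by
    refine hasDerivAt_integral_of_continuousOn_compact
      (X := sphere (0 : EuclideanSpace ℝ (Fin d)) 1) (F' := fun φ ω ↦
      ((inner ℝ (ω : EuclideanSpace ℝ (Fin d)) (u' φ) : ℝ) ^ 2 *
        G' (inner ℝ (ω : EuclideanSpace ℝ (Fin d)) (u φ)) -
      inner ℝ (ω : EuclideanSpace ℝ (Fin d)) (u φ) *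
        G (inner ℝ (ω : EuclideanSpace ℝ (Fin d)) (u φ)))) one_pos ?_ ?_ ?_
    · intro φ _
      refine Continuous.mul (by fun_prop) ?_
      exact hGc.comp_continuous (by fun_prop) (hmem φ)
    · refine ContinuousOn.sub (ContinuousOn.mul (by fun_prop) ?_)
        (ContinuousOn.mul (by fun_prop) ?_)
      · exact (hG'.comp_continuous (f := fun z : ℝ × sphere (0 : EuclideanSpace ℝ (Fin d)) 1 ↦
          inner ℝ (z.2 : EuclideanSpace ℝ (Fin d)) (u z.1)) (by fun_prop)
          (fun z ↦ hmem z.1 z.2)).continuousOn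
      · exact (hGc.comp_continuous (f := fun z : ℝ × sphere (0 : EuclideanSpace ℝ (Fin d)) 1 ↦
          inner ℝ (z.2 : EuclideanSpace ℝ (Fin d)) (u z.1)) (by fun_prop)
          (fun z ↦ hmem z.1 z.2)).continuousOn
    · intro φ _ ω
      have e1 : HasDerivAt (fun φ ↦ (inner ℝ (ω : EuclideanSpace ℝ (Fin d)) (u φ) : ℝ))
          (inner ℝ (ω : EuclideanSpace ℝ (Fin d)) (u' φ)) φ := by
        simp only [hu, hu', inner_add_right, real_inner_smul_right]
        exact ((Real.hasDerivAt_cos φ).mul_const _).add ((Real.hasDerivAt_sin φ).mul_const _)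
      have e2 : HasDerivAt (fun φ ↦ (inner ℝ (ω : EuclideanSpace ℝ (Fin d)) (u' φ) : ℝ))
          (-inner ℝ (ω : EuclideanSpace ℝ (Fin d)) (u φ)) φ := by
        simp only [hu, hu', inner_add_right, real_inner_smul_right]
        convert! ((Real.hasDerivAt_sin φ).fun_neg.mul_const _).add
          ((Real.hasDerivAt_cos φ).mul_const _) using 1
        ring
      convert! e2.mul ((hG _ (hmem φ ω)).comp φ e1) using 1
      simp only [Function.comp]
      ring
  have h0 := hder.unique ((hasDerivAt_const (0 : ℝ) _).congr_of_eventuallyEq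
    (Filter.Eventually.of_forall hconst))
  simpa [hu, hu'] using h0

end Sphere

/-! ### The mean value property of the Coulomb kernel -/

section Newton

variable {d : ℕ}

lemma integrable_sphereProb (hd : 2 ≤ d) {f : sphere (0 : EuclideanSpace ℝ (Fin d)) 1 → ℝ}
    (hf : Continuous f) : Integrable f (sphereProb d) := by
  have := isProbabilityMeasure_sphereProb hd
  exact hf.integrable_of_hasCompactSupport (HasCompactSupport.of_compactSpace _)

/-- The divergence theorem on the sphere for the tangential part of the field `G(⟨ω, e⟩) e`: the sum
of the rotation identities over the `d - 1` vectors `w` completing `e` to an orthonormal basis. -/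
lemma integral_one_sub_sq_mul_deriv (hd : 2 ≤ d) {e : EuclideanSpace ℝ (Fin d)} (he : ‖e‖ = 1)
    {G G' : ℝ → ℝ} (hG : ∀ a ∈ Icc (-1 : ℝ) 1, HasDerivAt G (G' a) a)
    (hG' : ContinuousOn G' (Icc (-1) 1)) :
    ∫ ω, ((1 - (inner ℝ (ω : EuclideanSpace ℝ (Fin d)) e : ℝ) ^ 2) *
        G' (inner ℝ (ω : EuclideanSpace ℝ (Fin d)) e) -
      ((d : ℝ) - 1) * (inner ℝ (ω : EuclideanSpace ℝ (Fin d)) e *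
        G (inner ℝ (ω : EuclideanSpace ℝ (Fin d)) e))) ∂(sphereProb d) = 0 := by
  have hd0 : 0 < d := by omega
  have hGc : ContinuousOn G (Icc (-1) 1) := fun a ha ↦ (hG a ha).continuousAt.continuousWithinAt
  have hmem : ∀ (ω : sphere (0 : EuclideanSpace ℝ (Fin d)) 1),
      inner ℝ (ω : EuclideanSpace ℝ (Fin d)) e ∈ Icc (-1 : ℝ) 1 := fun ω ↦
    inner_mem_Icc (by simp) he
  obtain ⟨b, hb⟩ := Orthonormal.exists_orthonormalBasis_extension_of_card_eq (𝕜 := ℝ)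
    (ι := Fin d) (E := EuclideanSpace ℝ (Fin d)) (by simp) (v := fun _ ↦ e) (s := {⟨0, hd0⟩})
    (by
      constructor
      · intro i
        simpa using he
      · intro i j hij
        exact absurd (Subsingleton.elim i j) hij)
  have hb0 : b ⟨0, hd0⟩ = e := hb _ rfl
  have hterm : ∀ i ∈ Finset.univ.erase (⟨0, hd0⟩ : Fin d),
      ∫ ω, ((inner ℝ (ω : EuclideanSpace ℝ (Fin d)) (b i) : ℝ) ^ 2 *
        G' (inner ℝ (ω : EuclideanSpace ℝ (Fin d)) e) -
      inner ℝ (ω : EuclideanSpace ℝ (Fin d)) e *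
        G (inner ℝ (ω : EuclideanSpace ℝ (Fin d)) e)) ∂(sphereProb d) = 0 := by
    intro i hi
    refine integral_inner_sq_mul_deriv hd he (b.norm_eq_one i) ?_ hG hG'
    rw [← hb0]
    exact b.inner_eq_zero (Finset.ne_of_mem_erase hi).symm
  rw [← Finset.sum_eq_zero hterm, ← integral_finsetSum]
  · congr 1
    ext ω
    have hsum : ∑ i, (inner ℝ (ω : EuclideanSpace ℝ (Fin d)) (b i) : ℝ) ^ 2 = 1 := by
      have := b.sum_sq_norm_inner_left (ω : EuclideanSpace ℝ (Fin d))
      simpa using this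
    rw [Finset.sum_sub_distrib, ← Finset.sum_mul, Finset.sum_const,
      Finset.card_erase_of_mem (Finset.mem_univ _), Finset.card_univ, Fintype.card_fin,
      nsmul_eq_mul, Nat.cast_sub (by omega), Nat.cast_one]
    rw [← Finset.add_sum_erase _ _ (Finset.mem_univ (⟨0, hd0⟩ : Fin d)), hb0] at hsum
    linear_combination (-G' (inner ℝ (ω : EuclideanSpace ℝ (Fin d)) e)) * hsum
  · intro i _
    refine integrable_sphereProb hd ?_
    refine Continuous.sub (Continuous.mul (by fun_prop) ?_) (Continuous.mul (by fun_prop) ?_)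
    · exact hG'.comp_continuous (by fun_prop) hmem
    · exact hGc.comp_continuous (by fun_prop) hmem

/-- The squared distance of `r e` from `ρ ω` is positive for `|ρ| < r`. Negative `ρ` are included so
that derivatives can be taken at `ρ = 0`. -/
lemma sq_dist_pos {r ρ a : ℝ} (hρ : |ρ| < r) (ha : a ∈ Icc (-1 : ℝ) 1) :
    0 < r ^ 2 + ρ ^ 2 - 2 * r * ρ * a := by
  have h1 : |ρ * a| ≤ |ρ| := by
    rw [abs_mul]
    exact mul_le_of_le_one_right (abs_nonneg _) (abs_le.2 ha)
  have h2 : ρ * a ≤ |ρ| := (le_abs_self _).trans h1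
  have h3 : 0 < r := (abs_nonneg _).trans_lt hρ
  have h4 : 0 < (r - |ρ|) ^ 2 := by
    have : 0 < r - |ρ| := by linarith
    positivity
  have h5 := sq_abs ρ
  nlinarith

/-- The flux through the sphere of radius `ρ` of the field of a point charge at distance `r > ρ`
vanishes: it does not depend on `ρ`, and it is zero for `ρ = 0`. The quantity
`r ^ 2 + ρ ^ 2 - 2 * r * ρ * ⟨ω, e⟩` is the squared distance of `ρ ω` from `r e`. -/
lemma integral_flux_eq_zero (hd : 2 ≤ d) {e : EuclideanSpace ℝ (Fin d)} (he : ‖e‖ = 1) {r ρ : ℝ}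
    (hρ0 : 0 < ρ) (hρ : ρ < r) :
    ∫ ω, (ρ - r * inner ℝ (ω : EuclideanSpace ℝ (Fin d)) e) *
      (r ^ 2 + ρ ^ 2 - 2 * r * ρ * inner ℝ (ω : EuclideanSpace ℝ (Fin d)) e) ^ (-((d : ℝ) / 2))
      ∂(sphereProb d) = 0 := by
  have := isProbabilityMeasure_sphereProb hd
  set p : ℝ := (d : ℝ) / 2 with hp
  have hdp : (d : ℝ) = 2 * p := by rw [hp]; ring
  have hmem : ∀ (ω : sphere (0 : EuclideanSpace ℝ (Fin d)) 1),
      inner ℝ (ω : EuclideanSpace ℝ (Fin d)) e ∈ Icc (-1 : ℝ) 1 := fun ω ↦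
    inner_mem_Icc (by simp) he
  set a : sphere (0 : EuclideanSpace ℝ (Fin d)) 1 → ℝ :=
    fun ω ↦ inner ℝ (ω : EuclideanSpace ℝ (Fin d)) e with ha
  have hac : Continuous a := by fun_prop
  set H : ℝ → ℝ := fun ρ ↦ ∫ ω, (ρ - r * a ω) * (r ^ 2 + ρ ^ 2 - 2 * r * ρ * a ω) ^ (-p)
    ∂(sphereProb d) with hH
  have hder : ∀ x, |x| < r → HasDerivAt H (∫ ω, ((r ^ 2 + x ^ 2 - 2 * r * x * a ω) ^ (-p) -
      2 * p * (x - r * a ω) ^ 2 * (r ^ 2 + x ^ 2 - 2 * r * x * a ω) ^ (-p - 1))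
      ∂(sphereProb d)) x := by
    intro x hx
    have hε : 0 < (r - |x|) / 2 := by linarith
    have hin : ∀ y ∈ closedBall x ((r - |x|) / 2), |y| < r := by
      intro y hy
      rw [mem_closedBall, Real.dist_eq] at hy
      have := abs_sub_abs_le_abs_sub y x
      linarith
    refine hasDerivAt_integral_of_continuousOn_compact (μ := sphereProb d)
      (F := fun x ω ↦ (x - r * a ω) * (r ^ 2 + x ^ 2 - 2 * r * x * a ω) ^ (-p))
      (F' := fun x ω ↦ ((r ^ 2 + x ^ 2 - 2 * r * x * a ω) ^ (-p) -
      2 * p * (x - r * a ω) ^ 2 * (r ^ 2 + x ^ 2 - 2 * r * x * a ω) ^ (-p - 1))) hε ?_ ?_ ?_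
    · intro y hy
      refine Continuous.mul (by fun_prop) (Continuous.rpow_const (by fun_prop) fun ω ↦ Or.inl ?_)
      exact (sq_dist_pos (hin y (ball_subset_closedBall hy)) (hmem ω)).ne'
    · refine ContinuousOn.sub ?_ (ContinuousOn.mul (by fun_prop) ?_)
      all_goals
        refine ContinuousOn.rpow_const (by fun_prop) fun z hz ↦ Or.inl ?_
        exact (sq_dist_pos (hin z.1 hz.1) (hmem z.2)).ne'
    · intro y hy ω
      have hs := sq_dist_pos (hin y (ball_subset_closedBall hy)) (hmem ω)
      have e1 : HasDerivAt (fun y ↦ r ^ 2 + y ^ 2 - 2 * r * y * a ω) (2 * y - 2 * r * a ω) y := by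
        have h1 := ((hasDerivAt_pow 2 y).const_add (r ^ 2)).sub
          (((hasDerivAt_id y).const_mul (2 * r)).mul_const (a ω))
        convert! h1 using 1
        simp
      have e2 := e1.rpow_const (p := -p) (Or.inl hs.ne')
      have e3 : HasDerivAt (fun y ↦ y - r * a ω) 1 y := (hasDerivAt_id y).sub_const _
      convert! e3.mul e2 using 1
      ring
  -- `x ^ (d - 1) * H x` is the flux; its derivative is `x ^ (d - 2)` times the left-hand side here,
  -- and harmonicity of the kernel turns that integrand into a divergence on the sphere.
  have hode : ∀ x, |x| < r → x * (∫ ω, ((r ^ 2 + x ^ 2 - 2 * r * x * a ω) ^ (-p) -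
      2 * p * (x - r * a ω) ^ 2 * (r ^ 2 + x ^ 2 - 2 * r * x * a ω) ^ (-p - 1))
      ∂(sphereProb d)) + ((d : ℝ) - 1) * H x = 0 := by
    intro x hx
    have hs : ∀ a ∈ Icc (-1 : ℝ) 1, 0 < r ^ 2 + x ^ 2 - 2 * r * x * a := fun a ha ↦
      sq_dist_pos hx ha
    have hdiv := integral_one_sub_sq_mul_deriv hd he
      (G := fun a ↦ r * (r ^ 2 + x ^ 2 - 2 * r * x * a) ^ (-p))
      (G' := fun a ↦ 2 * p * r ^ 2 * x * (r ^ 2 + x ^ 2 - 2 * r * x * a) ^ (-p - 1))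
      (by
        intro a ha
        have e1 : HasDerivAt (fun a ↦ r ^ 2 + x ^ 2 - 2 * r * x * a) (-(2 * r * x)) a := by
          have h1 := ((hasDerivAt_id a).const_mul (2 * r * x)).const_sub (r ^ 2 + x ^ 2)
          convert! h1 using 1
          simp
        convert! (e1.rpow_const (p := -p) (Or.inl (hs a ha).ne')).const_mul r using 1
        ring)
      (by
        refine ContinuousOn.mul (by fun_prop) ?_
        exact ContinuousOn.rpow_const (by fun_prop) fun a ha ↦ Or.inl (hs a ha).ne')
    have hc : ∀ q : ℝ, Continuous fun ω ↦ (r ^ 2 + x ^ 2 - 2 * r * x * a ω) ^ q := fun q ↦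
      Continuous.rpow_const (by fun_prop) fun ω ↦ Or.inl (hs _ (hmem ω)).ne'
    rw [hH, ← integral_const_mul, ← integral_const_mul, ← integral_add, ← hdiv]
    · congr 1
      ext ω
      have hsω := hs _ (hmem ω)
      have e1 : (r ^ 2 + x ^ 2 - 2 * r * x * a ω) ^ (-p) =
          (r ^ 2 + x ^ 2 - 2 * r * x * a ω) ^ (-p - 1) * (r ^ 2 + x ^ 2 - 2 * r * x * a ω) := by
        rw [← Real.rpow_add_one hsω.ne']
        congr 1
        ring
      change _ = (1 - a ω ^ 2) * _ - _ * (a ω * (r * (r ^ 2 + x ^ 2 - 2 * r * x * a ω) ^ (-p)))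
      rw [e1, hdp]
      ring
    · have := hc (-p)
      have := hc (-p - 1)
      exact integrable_sphereProb hd (by fun_prop)
    · have := hc (-p)
      exact integrable_sphereProb hd (by fun_prop)
  have hconst : ∀ x ∈ Icc 0 ρ, x ^ (d - 1) * H x = (0 : ℝ) ^ (d - 1) * H 0 := by
    have hlt : ∀ x ∈ Icc 0 ρ, |x| < r := fun x hx ↦ by
      rw [abs_of_nonneg hx.1]; exact hx.2.trans_lt hρ
    have hD : ∀ x ∈ Icc 0 ρ, HasDerivAt (fun x ↦ x ^ (d - 1) * H x) 0 x := by
      intro x hx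
      convert! (hasDerivAt_pow (d - 1) x).mul (hder x (hlt x hx)) using 1
      obtain ⟨k, rfl⟩ : ∃ k, d = k + 2 := ⟨d - 2, by omega⟩
      have h := hode x (hlt x hx)
      have e1 : k + 2 - 1 = k + 1 := by omega
      rw [e1, Nat.add_sub_cancel]
      push_cast at h ⊢
      linear_combination (-x ^ k) * h
    exact constant_of_has_deriv_right_zero
      (fun x hx ↦ (hD x hx).continuousAt.continuousWithinAt)
      (fun x hx ↦ (hD x ⟨hx.1, hx.2.le⟩).hasDerivWithinAt)
  have h := hconst ρ ⟨hρ0.le, le_rfl⟩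
  rw [zero_pow (by omega), zero_mul] at h
  exact (mul_eq_zero.1 h).resolve_left (by positivity)

/-- The normalized Coulomb kernel, as a real function of the squared distance `s > 0`. It is
negative for `s > 4`, where `coulomb` vanishes. -/
noncomputable def coulombReal (p s : ℝ) : ℝ := ∫ v in s..4, v ^ (-p)

lemma intervalIntegrable_rpow_neg (p : ℝ) {s t : ℝ} (hs : 0 < s) (ht : 0 < t) :
    IntervalIntegrable (fun v : ℝ ↦ v ^ (-p)) volume s t := by
  refine ContinuousOn.intervalIntegrable fun v hv ↦ ?_
  have : 0 < v := (lt_min hs ht).trans_le hv.1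
  exact (Real.continuousAt_rpow_const v _ (Or.inl this.ne')).continuousWithinAt

lemma hasDerivAt_coulombReal (p : ℝ) {s : ℝ} (hs : 0 < s) :
    HasDerivAt (coulombReal p) (-s ^ (-p)) s := by
  refine intervalIntegral.integral_hasDerivAt_left
    (intervalIntegrable_rpow_neg p hs (by norm_num)) ?_
    (Real.continuousAt_rpow_const s _ (Or.inl hs.ne'))
  exact (measurable_id.pow_const _).stronglyMeasurable.stronglyMeasurableAtFilter

lemma coulomb_eq_ofReal (p : ℝ) {s : ℝ} (hs : 0 < s) :
    coulomb p s = ENNReal.ofReal (coulombReal p s) := by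
  rcases le_or_gt s 4 with h | h
  · rw [coulombReal, intervalIntegral.integral_of_le h, ofReal_integral_eq_lintegral_ofReal
      (intervalIntegrable_rpow_neg p hs (by norm_num)).1, coulomb]
    filter_upwards [ae_restrict_mem measurableSet_Ioc] with v hv
    have : 0 < v := hs.trans hv.1
    simp only [Pi.zero_apply]
    positivity
  · rw [coulomb, Ioc_eq_empty_of_le h.le, Measure.restrict_empty, lintegral_zero_measure,
      coulombReal, intervalIntegral.integral_symm, eq_comm, ENNReal.ofReal_eq_zero, neg_nonpos]
    refine intervalIntegral.integral_nonneg h.le fun v hv ↦ ?_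
    have : 0 < v := lt_of_lt_of_le (by norm_num) hv.1
    positivity

/-- The mean value property of the Coulomb kernel on spheres that do not surround the pole. -/
lemma integral_coulombReal (hd : 2 ≤ d) {e : EuclideanSpace ℝ (Fin d)} (he : ‖e‖ = 1) {r ρ : ℝ}
    (hρ0 : 0 ≤ ρ) (hρ : ρ < r) :
    ∫ ω, coulombReal ((d : ℝ) / 2)
      (r ^ 2 + ρ ^ 2 - 2 * r * ρ * inner ℝ (ω : EuclideanSpace ℝ (Fin d)) e) ∂(sphereProb d) =
      coulombReal ((d : ℝ) / 2) (r ^ 2) := by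
  have := isProbabilityMeasure_sphereProb hd
  have hmem : ∀ (ω : sphere (0 : EuclideanSpace ℝ (Fin d)) 1),
      inner ℝ (ω : EuclideanSpace ℝ (Fin d)) e ∈ Icc (-1 : ℝ) 1 := fun ω ↦
    inner_mem_Icc (by simp) he
  have hflux : ∀ x, 0 < x → x < r → _ := fun x hx hx' ↦ integral_flux_eq_zero hd he hx hx'
  set p : ℝ := (d : ℝ) / 2 with hp
  set a : sphere (0 : EuclideanSpace ℝ (Fin d)) 1 → ℝ :=
    fun ω ↦ inner ℝ (ω : EuclideanSpace ℝ (Fin d)) e with ha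
  have hac : Continuous a := by fun_prop
  have hcont : ContinuousOn (coulombReal p) (Ioi 0) := fun s hs ↦
    (hasDerivAt_coulombReal p hs).continuousAt.continuousWithinAt
  set M : ℝ → ℝ := fun ρ ↦ ∫ ω, coulombReal p (r ^ 2 + ρ ^ 2 - 2 * r * ρ * a ω) ∂(sphereProb d)
    with hM
  have hder : ∀ x, |x| < r → HasDerivAt M (∫ ω, (-2) * ((x - r * a ω) *
      (r ^ 2 + x ^ 2 - 2 * r * x * a ω) ^ (-p)) ∂(sphereProb d)) x := by
    intro x hx
    have hε : 0 < (r - |x|) / 2 := by linarith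
    have hin : ∀ y ∈ closedBall x ((r - |x|) / 2), |y| < r := by
      intro y hy
      rw [mem_closedBall, Real.dist_eq] at hy
      have := abs_sub_abs_le_abs_sub y x
      linarith
    refine hasDerivAt_integral_of_continuousOn_compact (μ := sphereProb d)
      (F := fun x ω ↦ coulombReal p (r ^ 2 + x ^ 2 - 2 * r * x * a ω))
      (F' := fun x ω ↦ (-2) * ((x - r * a ω) *
      (r ^ 2 + x ^ 2 - 2 * r * x * a ω) ^ (-p))) hε ?_ ?_ ?_
    · intro y hy
      exact hcont.comp_continuous (by fun_prop) fun ω ↦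
        sq_dist_pos (hin y (ball_subset_closedBall hy)) (hmem ω)
    · refine ContinuousOn.mul (by fun_prop) (ContinuousOn.mul (by fun_prop) ?_)
      refine ContinuousOn.rpow_const (by fun_prop) fun z hz ↦ Or.inl ?_
      exact (sq_dist_pos (hin z.1 hz.1) (hmem z.2)).ne'
    · intro y hy ω
      have hs := sq_dist_pos (hin y (ball_subset_closedBall hy)) (hmem ω)
      have e1 : HasDerivAt (fun y ↦ r ^ 2 + y ^ 2 - 2 * r * y * a ω) (2 * y - 2 * r * a ω) y := by
        have h1 := ((hasDerivAt_pow 2 y).const_add (r ^ 2)).sub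
          (((hasDerivAt_id y).const_mul (2 * r)).mul_const (a ω))
        convert! h1 using 1
        simp
      convert! (hasDerivAt_coulombReal p hs).comp y e1 using 1
      ring
  have hlt : ∀ x ∈ Icc 0 ρ, |x| < r := fun x hx ↦ by
    rw [abs_of_nonneg hx.1]; exact hx.2.trans_lt hρ
  have hconst : ∀ x ∈ Icc 0 ρ, M x = M 0 := by
    have hder0 : ∀ x ∈ Icc 0 ρ, 0 < x → HasDerivAt M 0 x := by
      intro x hx hx0
      convert! hder x (hlt x hx) using 1
      rw [integral_const_mul, hflux x hx0 (hx.2.trans_lt hρ), mul_zero]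
    intro x hx
    rcases hx.1.eq_or_lt with h | h
    · rw [← h]
    · obtain ⟨c, hc, hc'⟩ := exists_hasDerivAt_eq_slope M (fun _ ↦ 0) h
        (fun y hy ↦ (hder y (hlt y ⟨hy.1, hy.2.trans hx.2⟩)).continuousAt.continuousWithinAt)
        (fun y hy ↦ hder0 y ⟨hy.1.le, hy.2.le.trans hx.2⟩ hy.1)
      rw [eq_comm, div_eq_zero_iff, sub_zero] at hc'
      linarith [hc'.resolve_right h.ne']
  have h0 : M 0 = coulombReal p (r ^ 2) := by simp [hM]
  exact (hconst ρ ⟨hρ0, le_rfl⟩).trans h0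

end Newton

/-! ### Newton's theorem -/

section Newton

variable {d : ℕ}

lemma norm_smul_sub_smul_sq {e ω : EuclideanSpace ℝ (Fin d)} (he : ‖e‖ = 1) (hω : ‖ω‖ = 1)
    (ρ r : ℝ) : ‖ρ • e - r • ω‖ ^ 2 = r ^ 2 + ρ ^ 2 - 2 * r * ρ * inner ℝ ω e := by
  rw [norm_sub_sq_real, norm_smul, norm_smul, he, hω, real_inner_smul_left, real_inner_smul_right,
    real_inner_comm, mul_one, mul_one, Real.norm_eq_abs, Real.norm_eq_abs, sq_abs, sq_abs]
  ring

/-- Lower semicontinuity, which at `s = 0` accounts for the infinite value. -/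
lemma coulomb_le_liminf (p s : ℝ) {u : ℕ → ℝ} (hu : Filter.Tendsto u Filter.atTop (nhds s)) :
    coulomb p s ≤ Filter.liminf (fun n ↦ coulomb p (u n)) Filter.atTop := by
  have hrep : ∀ s, coulomb p s = ∫⁻ v in Iic 4, (Ioi s).indicator
      (fun v ↦ ENNReal.ofReal (v ^ (-p))) v := by
    intro s
    rw [setLIntegral_indicator measurableSet_Ioi, Ioi_inter_Iic, coulomb]
  simp_rw [hrep]
  refine le_trans (lintegral_mono fun v ↦ ?_) (lintegral_liminf_le fun n ↦
    (by fun_prop : Measurable fun v : ℝ ↦ ENNReal.ofReal (v ^ (-p))).indicator measurableSet_Ioi)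
  by_cases hv : s < v
  · refine Filter.le_liminf_of_le (by isBoundedDefault) ?_
    filter_upwards [hu.eventually (gt_mem_nhds hv)] with n hn
    rw [indicator_of_mem (mem_Ioi.2 hv), indicator_of_mem (mem_Ioi.2 hn)]
  · rw [indicator_of_notMem (by simpa using hv)]
    exact zero_le

lemma integral_coulombReal_smul (hd : 2 ≤ d) {e : EuclideanSpace ℝ (Fin d)} (he : ‖e‖ = 1)
    {r ρ : ℝ} (hρ0 : 0 ≤ ρ) (hρ : ρ < r) :
    ∫ ω, coulombReal ((d : ℝ) / 2) (‖ρ • e - r • (ω : EuclideanSpace ℝ (Fin d))‖ ^ 2)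
      ∂(sphereProb d) = coulombReal ((d : ℝ) / 2) (r ^ 2) := by
  rw [← integral_coulombReal hd he hρ0 hρ]
  congr 1
  ext ω
  rw [norm_smul_sub_smul_sq he (by simp)]

lemma norm_smul_sub_smul_sq_pos {e ω : EuclideanSpace ℝ (Fin d)} (he : ‖e‖ = 1) (hω : ‖ω‖ = 1)
    {r ρ : ℝ} (hρ0 : 0 ≤ ρ) (hρ : ρ < r) : 0 < ‖ρ • e - r • ω‖ ^ 2 := by
  rw [norm_smul_sub_smul_sq he hω]
  exact sq_dist_pos (by rwa [abs_of_nonneg hρ0]) (inner_mem_Icc hω he)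

lemma integrable_coulombReal_smul (hd : 2 ≤ d) {e : EuclideanSpace ℝ (Fin d)} (he : ‖e‖ = 1)
    {r ρ : ℝ} (hρ0 : 0 ≤ ρ) (hρ : ρ < r) :
    Integrable (fun ω : sphere (0 : EuclideanSpace ℝ (Fin d)) 1 ↦ coulombReal ((d : ℝ) / 2)
      (‖ρ • e - r • (ω : EuclideanSpace ℝ (Fin d))‖ ^ 2)) (sphereProb d) := by
  refine integrable_sphereProb hd ?_
  have hcont : ContinuousOn (coulombReal ((d : ℝ) / 2)) (Ioi 0) := fun s hs ↦
    (hasDerivAt_coulombReal _ hs).continuousAt.continuousWithinAt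
  exact hcont.comp_continuous (by fun_prop) fun ω ↦
    norm_smul_sub_smul_sq_pos he (by simp) hρ0 hρ

/-- Half of the mean value property without the restriction to radii at most one: the truncation of
the kernel to nonnegative values can only increase the integral. -/
lemma coulomb_le_lintegral_sphere (hd : 2 ≤ d) {e : EuclideanSpace ℝ (Fin d)} (he : ‖e‖ = 1)
    {r ρ : ℝ} (hρ0 : 0 ≤ ρ) (hρ : ρ < r) :
    coulomb ((d : ℝ) / 2) (r ^ 2) ≤
      ∫⁻ ω, coulomb ((d : ℝ) / 2) (‖ρ • e - r • (ω : EuclideanSpace ℝ (Fin d))‖ ^ 2)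
      ∂(sphereProb d) := by
  have hr : 0 < r := hρ0.trans_lt hρ
  rw [coulomb_eq_ofReal _ (by positivity), ← integral_coulombReal_smul hd he hρ0 hρ]
  rw [integral_eq_lintegral_pos_part_sub_lintegral_neg_part
    (integrable_coulombReal_smul hd he hρ0 hρ)]
  refine (ENNReal.ofReal_le_ofReal (sub_le_self _ ENNReal.toReal_nonneg)).trans
    (ENNReal.ofReal_toReal_le.trans (lintegral_mono fun ω ↦ ?_))
  rw [coulomb_eq_ofReal]
  exact norm_smul_sub_smul_sq_pos he (by simp) hρ0 hρ

lemma coulombReal_nonneg (p : ℝ) {s : ℝ} (hs : 0 < s) (hs4 : s ≤ 4) : 0 ≤ coulombReal p s :=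
  intervalIntegral.integral_nonneg hs4 fun v hv ↦ by
    have : 0 < v := hs.trans_le hv.1
    positivity

lemma lintegral_coulomb_sphere_of_lt (hd : 2 ≤ d) {e : EuclideanSpace ℝ (Fin d)} (he : ‖e‖ = 1)
    {r ρ : ℝ} (hρ0 : 0 ≤ ρ) (hρ : ρ < r) (hr : r ≤ 1) :
    ∫⁻ ω, coulomb ((d : ℝ) / 2) (‖ρ • e - r • (ω : EuclideanSpace ℝ (Fin d))‖ ^ 2)
      ∂(sphereProb d) = coulomb ((d : ℝ) / 2) (r ^ 2) := by
  have hr0 : 0 < r := hρ0.trans_lt hρ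
  have hpos : ∀ ω : sphere (0 : EuclideanSpace ℝ (Fin d)) 1,
      0 < ‖ρ • e - r • (ω : EuclideanSpace ℝ (Fin d))‖ ^ 2 := fun ω ↦
    norm_smul_sub_smul_sq_pos he (by simp) hρ0 hρ
  rw [coulomb_eq_ofReal _ (by positivity), ← integral_coulombReal_smul hd he hρ0 hρ,
    ofReal_integral_eq_lintegral_ofReal (integrable_coulombReal_smul hd he hρ0 hρ)]
  · exact lintegral_congr fun ω ↦ coulomb_eq_ofReal _ (hpos ω)
  · filter_upwards with ω
    refine coulombReal_nonneg _ (hpos ω) ?_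
    have h := norm_sub_le (ρ • e) (r • (ω : EuclideanSpace ℝ (Fin d)))
    rw [norm_smul, norm_smul, he, norm_eq_of_mem_sphere, Real.norm_of_nonneg hρ0,
      Real.norm_of_nonneg hr0.le] at h
    nlinarith [norm_nonneg (ρ • e - r • (ω : EuclideanSpace ℝ (Fin d)))]

/-- The pole may lie on the sphere. The upper bound comes from poles `r (1 - δ) e` moving out to the
sphere, by Fatou's lemma; the lower bound from spheres of radius `r (1 + δ)` shrinking to it, whose
points are further away from the pole. -/
lemma lintegral_coulomb_sphere_of_eq (hd : 2 ≤ d) {e : EuclideanSpace ℝ (Fin d)} (he : ‖e‖ = 1)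
    {r : ℝ} (hr0 : 0 < r) (hr : r ≤ 1) :
    ∫⁻ ω, coulomb ((d : ℝ) / 2) (‖r • e - r • (ω : EuclideanSpace ℝ (Fin d))‖ ^ 2)
      ∂(sphereProb d) = coulomb ((d : ℝ) / 2) (r ^ 2) := by
  have hlim : Filter.Tendsto (fun n : ℕ ↦ 1 / ((n : ℝ) + 1)) Filter.atTop (nhds 0) :=
    tendsto_one_div_add_atTop_nhds_zero_nat
  apply le_antisymm
  · have hstep : ∀ n : ℕ, ∫⁻ ω, coulomb ((d : ℝ) / 2)
        (‖r • e - r • (ω : EuclideanSpace ℝ (Fin d))‖ ^ 2 + (r * (1 / ((n : ℝ) + 1))) ^ 2)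
        ∂(sphereProb d) ≤ coulomb ((d : ℝ) / 2) (r ^ 2) := by
      intro n
      have hn : 0 < 1 / ((n : ℝ) + 1) := by positivity
      have hn1 : 1 / ((n : ℝ) + 1) ≤ 1 := by
        rw [div_le_one (by positivity)]
        linarith [n.cast_nonneg (α := ℝ)]
      set δ := 1 / ((n : ℝ) + 1)
      rw [← lintegral_coulomb_sphere_of_lt hd he (ρ := r * (1 - δ))
        (mul_nonneg hr0.le (by linarith)) (by nlinarith) hr]
      refine lintegral_mono fun ω ↦ coulomb_anti _ ?_
      rw [norm_smul_sub_smul_sq he (by simp), norm_smul_sub_smul_sq he (by simp)]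
      have := (inner_mem_Icc (norm_eq_of_mem_sphere ω) he).2
      nlinarith [mul_nonneg (mul_nonneg (sq_nonneg r) hn.le) (sub_nonneg.2 this)]
    have hbd := Filter.liminf_le_of_frequently_le' (f := Filter.atTop)
      (Filter.Frequently.of_forall hstep)
    refine le_trans (le_trans (lintegral_mono fun ω ↦ ?_) (lintegral_liminf_le fun n ↦ ?_)) hbd
    · refine coulomb_le_liminf _ _ ?_
      have := ((hlim.const_mul r).pow 2).const_add
        (‖r • e - r • (ω : EuclideanSpace ℝ (Fin d))‖ ^ 2)
      simpa using this
    · exact (measurable_coulomb _).comp (by fun_prop)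
  · have hstep : ∀ n : ℕ, coulomb ((d : ℝ) / 2) ((r * (1 + 1 / ((n : ℝ) + 1))) ^ 2) ≤
        ∫⁻ ω, coulomb ((d : ℝ) / 2) (‖r • e - r • (ω : EuclideanSpace ℝ (Fin d))‖ ^ 2)
        ∂(sphereProb d) := by
      intro n
      have hn : 0 < 1 / ((n : ℝ) + 1) := by positivity
      set δ := 1 / ((n : ℝ) + 1)
      refine (coulomb_le_lintegral_sphere hd he hr0.le (r := r * (1 + δ)) (by nlinarith)).trans
        (lintegral_mono fun ω ↦ coulomb_anti _ ?_)
      rw [norm_smul_sub_smul_sq he (by simp), norm_smul_sub_smul_sq he (by simp)]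
      have := (inner_mem_Icc (norm_eq_of_mem_sphere ω) he).2
      nlinarith [mul_nonneg (mul_nonneg (sq_nonneg r) hn.le) (sub_nonneg.2 this),
        sq_nonneg (r * δ)]
    refine (coulomb_le_liminf _ _ (u := fun n : ℕ ↦ (r * (1 + 1 / ((n : ℝ) + 1))) ^ 2) ?_).trans
      (Filter.liminf_le_of_frequently_le' (Filter.Frequently.of_forall hstep))
    simpa using ((hlim.const_add 1).const_mul r).pow 2

/-- Newton's theorem: inside a sphere its potential is constant, outside it is that of a point
charge at the centre. -/
theorem lintegral_coulomb_sphere (hd : 2 ≤ d) {x : EuclideanSpace ℝ (Fin d)} (hx : ‖x‖ ≤ 1) {r : ℝ}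
    (hr0 : 0 ≤ r) (hr : r ≤ 1) :
    ∫⁻ ω, coulomb ((d : ℝ) / 2) (‖x - r • (ω : EuclideanSpace ℝ (Fin d))‖ ^ 2) ∂(sphereProb d) =
      coulomb ((d : ℝ) / 2) (max ‖x‖ r ^ 2) := by
  have := isProbabilityMeasure_sphereProb hd
  have hne : NeZero d := ⟨by omega⟩
  obtain ⟨e, he, hxe⟩ : ∃ e : EuclideanSpace ℝ (Fin d), ‖e‖ = 1 ∧ x = ‖x‖ • e := by
    rcases eq_or_ne x 0 with rfl | h0
    · obtain ⟨e, he⟩ := exists_norm_eq (EuclideanSpace ℝ (Fin d)) zero_le_one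
      exact ⟨e, he, by simp⟩
    · refine ⟨‖x‖⁻¹ • x, ?_, ?_⟩
      · rw [norm_smul, norm_inv, norm_norm, inv_mul_cancel₀ (norm_ne_zero_iff.2 h0)]
      · rw [smul_smul, mul_inv_cancel₀ (norm_ne_zero_iff.2 h0), one_smul]
  generalize hρ : ‖x‖ = ρ at *
  have hρ0 : 0 ≤ ρ := hρ ▸ norm_nonneg x
  subst hxe
  rcases lt_trichotomy ρ r with h | h | h
  · rw [max_eq_right h.le, lintegral_coulomb_sphere_of_lt hd he hρ0 h hr]
  · subst h
    rw [max_self]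
    rcases hρ0.eq_or_lt with h0 | h0
    · simp [← h0]
    · exact lintegral_coulomb_sphere_of_eq hd he h0 hr
  · -- The distances `|ρ e - r ω|` and `|r e - ρ ω|` agree, which exchanges inside and outside.
    rw [max_eq_left h.le, ← lintegral_coulomb_sphere_of_lt hd he hr0 h hx]
    refine lintegral_congr fun ω ↦ ?_
    rw [norm_smul_sub_smul_sq he (by simp), norm_smul_sub_smul_sq he (by simp)]
    congr 1
    ring

end Newton

/-! ### The radial mass and the potential of `τ` -/

section Potentials

variable {d : ℕ}

/-- The radial density of `τ`. -/
noncomputable def tauDensity (d : ℕ) (γ h r : ℝ) : ENNReal :=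
  ENNReal.ofReal (-(d * γ * h ^ 2) * (r ^ (d - 1) / (r ^ 2 + h ^ 2) ^ (1 + (d : ℝ) / 2)))

/-- The mass that the density of `τ` puts on the ball of radius `√v`. -/
noncomputable def radialMass (d : ℕ) (γ h v : ℝ) : ℝ := -γ * (v / (v + h ^ 2)) ^ ((d : ℝ) / 2)

@[fun_prop]
lemma measurable_tauDensity (d : ℕ) (γ h : ℝ) : Measurable (tauDensity d γ h) := by
  unfold tauDensity
  fun_prop

@[fun_prop]
lemma measurable_radialMass (d : ℕ) (γ h : ℝ) : Measurable (radialMass d γ h) := by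
  unfold radialMass
  fun_prop

lemma lintegral_tau (hd : 2 ≤ d) (γ h : ℝ) {g : EuclideanSpace ℝ (Fin d) → ENNReal}
    (hg : Measurable g) :
    ∫⁻ x, g x ∂(tau d γ h) = ∫⁻ r in Icc 0 (radius d γ h), tauDensity d γ h r *
      ∫⁻ ω, g (r • (ω : EuclideanSpace ℝ (Fin d))) ∂(sphereProb d) := by
  have := isProbabilityMeasure_sphereProb hd
  have hm : Measurable fun z : ℝ × sphere (0 : EuclideanSpace ℝ (Fin d)) 1 ↦
      g (z.1 • (z.2 : EuclideanSpace ℝ (Fin d))) := hg.comp (by fun_prop)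
  rw [tau, lintegral_map hg (by fun_prop), lintegral_prod _ hm.aemeasurable]
  exact lintegral_withDensity_eq_lintegral_mul _ (measurable_tauDensity d γ h)
    hm.lintegral_prod_right

lemma lintegral_sigma {g : EuclideanSpace ℝ (Fin d) → ENNReal} (hg : Measurable g) :
    ∫⁻ x, g x ∂(sigma d) = ∫⁻ ω, g (ω : EuclideanSpace ℝ (Fin d)) ∂(sphereProb d) :=
  lintegral_map hg measurable_subtype_coe

lemma ae_tau_norm_le (hd : 2 ≤ d) (γ h : ℝ) : ∀ᵐ x ∂(tau d γ h), ‖x‖ ≤ radius d γ h := by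
  have hm : MeasurableSet {x : EuclideanSpace ℝ (Fin d) | ‖x‖ ≤ radius d γ h}ᶜ :=
    (measurableSet_le (by fun_prop) (by fun_prop)).compl
  rw [ae_iff]
  change tau d γ h {x | ‖x‖ ≤ radius d γ h}ᶜ = 0
  rw [← lintegral_indicator_one hm, lintegral_tau hd γ h (measurable_one.indicator hm)]
  refine (setLIntegral_congr_fun measurableSet_Icc fun r hr ↦ ?_).trans lintegral_zero
  have h0 : ∀ ω : sphere (0 : EuclideanSpace ℝ (Fin d)) 1,
      ({x | ‖x‖ ≤ radius d γ h}ᶜ : Set (EuclideanSpace ℝ (Fin d))).indicator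
        (1 : EuclideanSpace ℝ (Fin d) → ENNReal) (r • (ω : EuclideanSpace ℝ (Fin d))) = 0 := by
    intro ω
    refine indicator_of_notMem ?_ _
    simp only [mem_compl_iff, mem_ofPred_eq, not_not]
    rw [norm_smul, norm_eq_of_mem_sphere, mul_one, Real.norm_of_nonneg hr.1]
    exact hr.2
  simp [h0]

lemma ae_sigma_norm_eq (d : ℕ) : ∀ᵐ x ∂(sigma d), ‖x‖ = 1 := by
  rw [sigma, ae_map_iff measurable_subtype_coe.aemeasurable
    (measurableSet_eq_fun (by fun_prop) (by fun_prop))]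
  exact Filter.Eventually.of_forall fun ω ↦ norm_eq_of_mem_sphere ω

lemma hasDerivAt_radialMass (hd : 2 ≤ d) {γ h : ℝ} (hh : 0 < h) {r : ℝ} (hr : 0 ≤ r) :
    HasDerivAt (fun r ↦ radialMass d γ h (r ^ 2))
      (-(d * γ * h ^ 2) * (r ^ (d - 1) / (r ^ 2 + h ^ 2) ^ (1 + (d : ℝ) / 2))) r := by
  have hd' : (2 : ℝ) ≤ d := by exact_mod_cast hd
  have hpos : 0 < r ^ 2 + h ^ 2 := by positivity
  have h1 : HasDerivAt (fun r : ℝ ↦ r ^ 2 / (r ^ 2 + h ^ 2))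
      ((2 * r * h ^ 2) / (r ^ 2 + h ^ 2) ^ 2) r := by
    have h2 : HasDerivAt (fun r : ℝ ↦ r ^ 2) (2 * r) r := by
      simpa using hasDerivAt_pow 2 r
    convert! h2.div (h2.add_const (h ^ 2)) hpos.ne' using 1
    ring
  have h2 := (h1.rpow_const (p := (d : ℝ) / 2) (Or.inr (by linarith))).const_mul (-γ)
  convert! h2 using 1
  have e1 : (r ^ 2) ^ ((d : ℝ) / 2 - 1) = r ^ (d - 2) := by
    rw [← Real.rpow_natCast r 2, ← Real.rpow_mul hr, ← Real.rpow_natCast r (d - 2),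
      Nat.cast_sub hd]
    congr 1
    push_cast
    ring
  have e2 : (r ^ 2 + h ^ 2) ^ (1 + (d : ℝ) / 2) =
      (r ^ 2 + h ^ 2) ^ ((d : ℝ) / 2 - 1) * (r ^ 2 + h ^ 2) ^ 2 := by
    rw [← Real.rpow_natCast (r ^ 2 + h ^ 2) 2, ← Real.rpow_add hpos]
    congr 1
    push_cast
    ring
  have e3 : r ^ (d - 1) = r ^ (d - 2) * r := by
    rw [← pow_succ]
    congr 1
    omega
  have hne : (r ^ 2 + h ^ 2) ^ ((d : ℝ) / 2 - 1) ≠ 0 := by positivity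
  rw [Real.div_rpow (by positivity) hpos.le, e1, e2, e3]
  field_simp

lemma setLIntegral_tauDensity (hd : 2 ≤ d) {γ h : ℝ} (hγ : γ ≤ 0) (hh : 0 < h) {q : ℝ}
    (hq : 0 ≤ q) :
    ∫⁻ r in Icc 0 q, tauDensity d γ h r = ENNReal.ofReal (radialMass d γ h (q ^ 2)) := by
  have hd0 : (d : ℝ) / 2 ≠ 0 := by
    have : (2 : ℝ) ≤ d := by exact_mod_cast hd
    positivity
  have hc : Continuous fun r : ℝ ↦
      -(d * γ * h ^ 2) * (r ^ (d - 1) / (r ^ 2 + h ^ 2) ^ (1 + (d : ℝ) / 2)) := by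
    refine Continuous.mul (by fun_prop) (Continuous.div (by fun_prop) ?_ fun r ↦ ?_)
    · exact Continuous.rpow_const (by fun_prop) fun r ↦ Or.inl (by positivity)
    · positivity
  simp only [tauDensity]
  rw [← ofReal_integral_eq_lintegral_ofReal hc.integrableOn_Icc, integral_Icc_eq_integral_Ioc,
    ← intervalIntegral.integral_of_le hq, intervalIntegral.integral_eq_sub_of_hasDerivAt
      (f := fun r ↦ radialMass d γ h (r ^ 2)) _ (hc.intervalIntegrable _ _)]
  · simp [radialMass, Real.zero_rpow hd0]
  · intro r hr
    rw [uIcc_of_le hq] at hr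
    exact hasDerivAt_radialMass hd hh hr.1
  · filter_upwards [ae_restrict_mem measurableSet_Icc] with r hr
    have := hr.1
    have h1 : 0 ≤ -(d * γ * h ^ 2) := by
      have : 0 ≤ (d : ℝ) * (-γ) * h ^ 2 := by
        have : 0 ≤ -γ := by linarith
        positivity
      linarith
    simp only [Pi.zero_apply]
    positivity

lemma tau_univ (hd : 2 ≤ d) {γ h : ℝ} (hγ : γ ≤ 0) (hh : 0 < h) (hR : 0 ≤ radius d γ h) :
    tau d γ h univ = ENNReal.ofReal (radialMass d γ h (radius d γ h ^ 2)) := by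
  have := isProbabilityMeasure_sphereProb hd
  rw [← setLIntegral_tauDensity hd hγ hh hR, ← lintegral_one, lintegral_tau hd γ h measurable_const]
  simp

/-- The potential of `τ`, written as an integral over the squared radius `v` of the mass inside. -/
lemma lintegral_coulomb_tau (hd : 2 ≤ d) {γ h : ℝ} (hγ : γ ≤ 0) (hh : 0 < h)
    (hR : 0 ≤ radius d γ h) (hR1 : radius d γ h ≤ 1) {x : EuclideanSpace ℝ (Fin d)}
    (hx : ‖x‖ ≤ 1) :
    ∫⁻ y, coulomb ((d : ℝ) / 2) (‖x - y‖ ^ 2) ∂(tau d γ h) =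
      ∫⁻ v in Ioc (‖x‖ ^ 2) 4, ENNReal.ofReal (v ^ (-((d : ℝ) / 2))) *
        ENNReal.ofReal (radialMass d γ h (min v (radius d γ h ^ 2))) := by
  rw [lintegral_tau hd γ h (g := fun y ↦ coulomb ((d : ℝ) / 2) (‖x - y‖ ^ 2)) (by fun_prop)]
  set R := radius d γ h
  have h1 : ∀ r ∈ Icc 0 R, tauDensity d γ h r *
      ∫⁻ ω, coulomb ((d : ℝ) / 2) (‖x - r • (ω : EuclideanSpace ℝ (Fin d))‖ ^ 2) ∂(sphereProb d) =
      ∫⁻ v in Ioc (‖x‖ ^ 2) 4, ENNReal.ofReal (v ^ (-((d : ℝ) / 2))) *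
        {z : ℝ × ℝ | z.1 ^ 2 < z.2}.indicator (fun z ↦ tauDensity d γ h z.1) (r, v) := by
    intro r hr
    rw [lintegral_coulomb_sphere hd hx hr.1 (hr.2.trans hR1)]
    have h2 : ∀ v, ENNReal.ofReal (v ^ (-((d : ℝ) / 2))) *
        {z : ℝ × ℝ | z.1 ^ 2 < z.2}.indicator (fun z ↦ tauDensity d γ h z.1) (r, v) =
        (Ioi (r ^ 2)).indicator (fun v ↦ tauDensity d γ h r *
          ENNReal.ofReal (v ^ (-((d : ℝ) / 2)))) v := by
      intro v
      by_cases hv : r ^ 2 < v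
      · rw [indicator_of_mem (by exact hv), indicator_of_mem (by exact hv), mul_comm]
      · rw [indicator_of_notMem (by exact hv), indicator_of_notMem (by exact hv), mul_zero]
    simp_rw [h2]
    rw [setLIntegral_indicator measurableSet_Ioi, lintegral_const_mul _ (by fun_prop), coulomb,
      inter_comm, Ioc_inter_Ioi]
    congr 3
    rcases le_total ‖x‖ r with h | h
    · rw [max_eq_right h, max_eq_right (pow_le_pow_left₀ (norm_nonneg _) h 2)]
    · rw [max_eq_left h, max_eq_left (pow_le_pow_left₀ hr.1 h 2)]
  have hms : MeasurableSet {z : ℝ × ℝ | z.1 ^ 2 < z.2} :=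
    measurableSet_lt (by fun_prop) (by fun_prop)
  have hmi : Measurable ({z : ℝ × ℝ | z.1 ^ 2 < z.2}.indicator (fun z ↦ tauDensity d γ h z.1)) :=
    Measurable.indicator (by fun_prop) hms
  rw [setLIntegral_congr_fun measurableSet_Icc h1, lintegral_lintegral_swap]
  · refine setLIntegral_congr_fun measurableSet_Ioc fun v hv ↦ ?_
    have hv0 : 0 < v := lt_of_le_of_lt (by positivity) hv.1
    rw [lintegral_const_mul _ (by fun_prop)]
    congr 1
    have h3 : ∀ r, {z : ℝ × ℝ | z.1 ^ 2 < z.2}.indicator (fun z ↦ tauDensity d γ h z.1) (r, v) =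
        {r : ℝ | r ^ 2 < v}.indicator (tauDensity d γ h) r := fun r ↦ rfl
    simp_rw [h3]
    rw [setLIntegral_indicator (measurableSet_lt (by fun_prop) (by fun_prop))]
    rcases lt_or_ge (R ^ 2) v with hRv | hRv
    · rw [min_eq_right hRv.le, ← setLIntegral_tauDensity hd hγ hh hR, inter_eq_self_of_subset_right]
      intro r hr
      exact (pow_le_pow_left₀ hr.1 hr.2 2).trans_lt hRv
    · have hset : {r : ℝ | r ^ 2 < v} ∩ Icc 0 R = Ico 0 (Real.sqrt v) := by
        ext r
        simp only [mem_inter_iff, mem_ofPred_eq, mem_Icc, mem_Ico]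
        constructor
        · rintro ⟨h1, h2, -⟩
          exact ⟨h2, Real.lt_sqrt_of_sq_lt h1⟩
        · rintro ⟨h1, h2⟩
          rw [Real.lt_sqrt h1] at h2
          exact ⟨h2, h1, (pow_le_pow_iff_left₀ h1 hR two_ne_zero).1 (h2.le.trans hRv)⟩
      rw [min_eq_left hRv, hset, setLIntegral_congr Ico_ae_eq_Icc,
        setLIntegral_tauDensity hd hγ hh (Real.sqrt_nonneg _), Real.sq_sqrt hv0.le]
  · apply Measurable.aemeasurable
    simp only [Function.uncurry_def]
    fun_prop

end Potentials

/-! ### The Frostman conditions are sufficient -/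

section Frostman

variable {V : Type*} [NormedAddCommGroup V] [InnerProductSpace ℝ V] [MeasurableSpace V]
  [FiniteDimensional ℝ V] [BorelSpace V]

lemma coulombEnergy_eq_lintegral (p : ℝ) (ν μ : Measure V) [SFinite μ] :
    coulombEnergy p ν μ = ∫⁻ x, ∫⁻ y, coulomb p (‖x - y‖ ^ 2) ∂μ ∂ν :=
  lintegral_prod _ (by fun_prop)

lemma lintegral_ne_top_of_le {X : Type*} [MeasurableSpace X] {W : X → ENNReal} {B : ENNReal}
    (hB : B ≠ ⊤) (hW : ∀ x, W x ≤ B) (ν : Measure X) [IsProbabilityMeasure ν] :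
    ∫⁻ x, W x ∂ν ≠ ⊤ := by
  refine ne_top_of_le_ne_top hB ((lintegral_mono hW).trans ?_)
  simp

/-- The Frostman conditions characterize the minimizer of `E(ν) - 2 ∫ W dν`: if the potential of
`μ` minus `W` is at least the constant `c - D` on the ball, and equal to it `μ`-almost everywhere,
then `μ` is the only minimizer. Subtractions are avoided by moving terms across. -/
theorem frostman {p : ℝ} (hp : 0 < p) {μ ν : Measure V}
    [IsProbabilityMeasure μ] [IsProbabilityMeasure ν]
    (hμ : μ (closedBall 0 1)ᶜ = 0) (hν : ν (closedBall 0 1)ᶜ = 0) {W : V → ENNReal}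
    {B c D : ENNReal} (hB : B ≠ ⊤) (hW : ∀ x, W x ≤ B) (hc : c ≠ ⊤) (hD : D ≠ ⊤)
    (hle : ∀ x ∈ closedBall (0 : V) 1, c + W x ≤ ∫⁻ y, coulomb p (‖x - y‖ ^ 2) ∂μ + D)
    (heq : ∀ᵐ x ∂μ, ∫⁻ y, coulomb p (‖x - y‖ ^ 2) ∂μ + D = c + W x) :
    coulombEnergy p μ μ + 2 * ∫⁻ x, W x ∂ν ≤ coulombEnergy p ν ν + 2 * ∫⁻ x, W x ∂μ ∧
      (coulombEnergy p ν ν + 2 * ∫⁻ x, W x ∂μ ≤ coulombEnergy p μ μ + 2 * ∫⁻ x, W x ∂ν →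
        ν = μ) := by
  have hWμ := lintegral_ne_top_of_le hB hW μ
  have hWν := lintegral_ne_top_of_le hB hW ν
  have h1 : coulombEnergy p μ μ + D = c + ∫⁻ x, W x ∂μ := by
    have := lintegral_congr_ae heq
    rwa [lintegral_add_right _ measurable_const, lintegral_add_left measurable_const,
      lintegral_const, lintegral_const, measure_univ, mul_one, mul_one,
      ← coulombEnergy_eq_lintegral] at this
  have h2 : c + ∫⁻ x, W x ∂ν ≤ coulombEnergy p ν μ + D := by
    have hν' : ∀ᵐ x ∂ν, x ∈ closedBall (0 : V) 1 := hν
    have := lintegral_mono_ae (hν'.mono hle)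
    rwa [lintegral_add_right _ measurable_const, lintegral_add_left measurable_const,
      lintegral_const, lintegral_const, measure_univ, mul_one, mul_one,
      ← coulombEnergy_eq_lintegral] at this
  have h3 := two_mul_coulombEnergy_le hp hν hμ
  have h4 := eq_of_two_mul_coulombEnergy_eq hp hν hμ
  have hμμ : coulombEnergy p μ μ ≠ ⊤ :=
    ne_top_of_le_ne_top (ENNReal.add_ne_top.2 ⟨hc, hWμ⟩) (le_self_add.trans h1.le)
  by_cases hνν : coulombEnergy p ν ν = ⊤
  · rw [hνν, top_add]
    refine ⟨le_top, fun h ↦ absurd h (not_le_of_gt ?_)⟩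
    exact (ENNReal.add_ne_top.2 ⟨hμμ, ENNReal.mul_ne_top (by simp) hWν⟩).lt_top
  · have hνμ : coulombEnergy p ν μ ≠ ⊤ := by
      intro h
      rw [h, ENNReal.mul_top (by simp), top_le_iff] at h3
      exact ENNReal.add_ne_top.2 ⟨hνν, hμμ⟩ h3
    replace h4 := h4 hνμ
    lift coulombEnergy p ν ν to NNReal using hνν with a
    lift coulombEnergy p μ μ to NNReal using hμμ with b
    lift coulombEnergy p ν μ to NNReal using hνμ with m
    lift ∫⁻ x, W x ∂μ to NNReal using hWμ with wμ
    lift ∫⁻ x, W x ∂ν to NNReal using hWν with wν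
    lift c to NNReal using hc
    lift D to NNReal using hD
    norm_cast at *
    simp only [← NNReal.coe_le_coe, ← NNReal.coe_inj, NNReal.coe_add, NNReal.coe_mul,
      NNReal.coe_ofNat] at *
    exact ⟨by linarith, fun h ↦ h4 (by linarith)⟩

end Frostman

/-! ### The kernel and the external field in terms of `coulomb` -/

section Kernel

/-- The value of the Coulomb kernel at distance `2`. -/
noncomputable def kernelShift (d : ℕ) : ℝ := if d = 2 then Real.log (1 / 2) else 1 / 2 ^ (d - 2)

/-- The factor between the normalized kernel `coulomb` and the Coulomb kernel. -/
noncomputable def kernelScale (d : ℕ) : ℝ := if d = 2 then 1 / 2 else (d : ℝ) / 2 - 1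

lemma kernelScale_pos {d : ℕ} (hd : 2 ≤ d) : 0 < kernelScale d := by
  unfold kernelScale
  split_ifs with h
  · norm_num
  · have : (3 : ℝ) ≤ d := by exact_mod_cast (by omega : 3 ≤ d)
    linarith

/-- The kernel of `ℝ^d` in terms of the squared distance, in both cases of its definition. -/
lemma kernelShift_add_mul_coulombReal {d : ℕ} (hd : 2 ≤ d) {s : ℝ} (hs : 0 < s) :
    kernelShift d + kernelScale d * coulombReal ((d : ℝ) / 2) s =
      if d = 2 then 1 / 2 * Real.log (1 / s) else 1 / s ^ ((d : ℝ) / 2 - 1) := by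
  unfold kernelShift kernelScale
  split_ifs with h
  · subst h
    have h1 : coulombReal (((2 : ℕ) : ℝ) / 2) s = Real.log (4 / s) := by
      rw [← integral_inv_of_pos hs (by norm_num), coulombReal]
      congr 1
      ext v
      norm_num [Real.rpow_neg_one]
    have h4 : Real.log 4 = 2 * Real.log 2 := by
      rw [show (4 : ℝ) = 2 ^ 2 by norm_num, Real.log_pow]
      norm_num
    rw [h1, Real.log_div (by norm_num) hs.ne', one_div s, Real.log_inv, one_div (2 : ℝ),
      Real.log_inv, h4]
    ring
  · have hd3 : (3 : ℝ) ≤ d := by exact_mod_cast (by omega : 3 ≤ d)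
    have h1 : coulombReal ((d : ℝ) / 2) s =
        ((4 : ℝ) ^ (-((d : ℝ) / 2) + 1) - s ^ (-((d : ℝ) / 2) + 1)) / (-((d : ℝ) / 2) + 1) := by
      refine integral_rpow (Or.inr ⟨by linarith, ?_⟩)
      rw [mem_uIcc]
      rintro (h | h) <;> linarith
    have h2 : (4 : ℝ) ^ (-((d : ℝ) / 2) + 1) = 1 / 2 ^ (d - 2) := by
      rw [show (4 : ℝ) = 2 ^ (2 : ℝ) by norm_num, ← Real.rpow_mul (by norm_num), one_div,
        ← Real.rpow_natCast 2 (d - 2), ← Real.rpow_neg (by norm_num), Nat.cast_sub hd]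
      congr 1
      push_cast
      ring
    have h3 : s ^ (-((d : ℝ) / 2) + 1) = 1 / s ^ ((d : ℝ) / 2 - 1) := by
      rw [one_div, ← Real.rpow_neg hs.le]
      congr 1
      ring
    have h4 : -((d : ℝ) / 2) + 1 ≠ 0 := by linarith
    rw [h1, ← h2, ← h3]
    rw [show (d : ℝ) / 2 - 1 = -(-((d : ℝ) / 2) + 1) by ring, neg_mul, mul_div_cancel₀ _ h4]
    ring

lemma coulomb_zero {p : ℝ} (hp : 1 ≤ p) : coulomb p 0 = ⊤ := by
  by_contra h
  have h1 : IntegrableOn (fun v : ℝ ↦ v ^ (-p)) (Ioc 0 4) := by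
    refine (lintegral_ofReal_ne_top_iff_integrable
      (by fun_prop : Measurable fun v : ℝ ↦ v ^ (-p)).aestronglyMeasurable ?_).1 h
    filter_upwards [ae_restrict_mem measurableSet_Ioc] with v hv
    have := hv.1
    simp only [Pi.zero_apply]
    positivity
  have h2 := (intervalIntegral.integrableOn_Ioo_rpow_iff (s := -p) (t := 4) (by norm_num)).1
    (h1.mono_set Ioo_subset_Ioc_self)
  linarith

lemma kernel_eq {d : ℕ} (hd : 2 ≤ d) {r : ℝ} (hr : 0 ≤ r) (hr2 : r ^ 2 ≤ 4) :
    kernel d r = (kernelShift d : EReal) +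
      (kernelScale d : EReal) * (coulomb ((d : ℝ) / 2) (r ^ 2) : EReal) := by
  have hd' : (2 : ℝ) ≤ d := by exact_mod_cast hd
  rcases hr.eq_or_lt with rfl | h
  · rw [zero_pow two_ne_zero, coulomb_zero (by linarith), EReal.coe_ennreal_top,
      EReal.coe_mul_top_of_pos (kernelScale_pos hd), EReal.coe_add_top]
    simp [kernel]
  · have hs : 0 < r ^ 2 := by positivity
    have h1 := kernelShift_add_mul_coulombReal hd hs
    rw [coulomb_eq_ofReal _ hs, EReal.coe_ennreal_ofReal, max_eq_left (coulombReal_nonneg _ hs hr2),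
      ← EReal.coe_mul, ← EReal.coe_add, h1, kernel, if_neg h.ne']
    split_ifs with h2
    · congr 1
      rw [one_div r, one_div (r ^ 2), Real.log_inv, Real.log_inv, Real.log_pow]
      push_cast
      ring
    · congr 2
      rw [← Real.rpow_natCast r 2, ← Real.rpow_mul hr, ← Real.rpow_natCast r (d - 2),
        Nat.cast_sub hd]
      congr 1
      push_cast
      ring

/-- The external field is `γ` times the Coulomb kernel at the distance to the point charge, whose
square is `‖x‖ ^ 2 + h ^ 2`. -/
lemma externalField_eq {d : ℕ} (hd : 2 ≤ d) (γ h : ℝ) {x : EuclideanSpace ℝ (Fin d)}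
    (hx : 0 < ‖x‖ ^ 2 + h ^ 2) :
    externalField d γ h x = ((γ * (kernelShift d +
      kernelScale d * coulombReal ((d : ℝ) / 2) (‖x‖ ^ 2 + h ^ 2)) : ℝ) : EReal) := by
  rw [kernelShift_add_mul_coulombReal hd hx, externalField, if_neg hx.ne']
  split_ifs with h2
  · congr 1
    ring
  · congr 1
    ring

end Kernel

/-! ### Extended-real integrals -/

section ExtendedIntegral

variable {X : Type*} [MeasurableSpace X]

lemma eintegral_affine {μ : Measure X} [IsProbabilityMeasure μ] {f : X → EReal}
    {g : X → ENNReal} (hg : Measurable g) {a b : ℝ} (hb : 0 < b)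
    (hf : ∀ᵐ x ∂μ, f x = (a : EReal) + (b : EReal) * (g x : EReal)) :
    eintegral μ f = (a : EReal) + (b : EReal) * ((∫⁻ x, g x ∂μ : ENNReal) : EReal) := by
  -- The identity `f = a + b g` with the negative parts moved across, so as to hold in `[0, ∞]`.
  have hpt : ∀ᵐ x ∂μ, (f x).toENNReal + ENNReal.ofReal (-a) =
      (-f x).toENNReal + (ENNReal.ofReal a + ENNReal.ofReal b * g x) := by
    filter_upwards [hf] with x hx
    rw [hx]
    induction hgx : g x using ENNReal.recTopCoe with
    | top => simp [EReal.coe_mul_top_of_pos hb, ENNReal.mul_top, hb]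
    | coe t =>
      have : (a : EReal) + (b : EReal) * (((t : NNReal) : ENNReal) : EReal) =
          ((a + b * t : ℝ) : EReal) := by
        push_cast
        rfl
      rw [this, ← EReal.coe_neg, EReal.real_coe_toENNReal, EReal.real_coe_toENNReal,
        ← ENNReal.ofReal_coe_nnreal, ← ENNReal.ofReal_mul hb.le]
      simp only [ENNReal.ofReal]
      norm_cast
      rw [← NNReal.coe_inj]
      push_cast
      have h1 := max_zero_sub_eq_self a
      have h2 := max_zero_sub_eq_self (a + b * t)
      have h3 : 0 ≤ b * t := by positivity
      simp only [Real.coe_toNNReal']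
      rw [max_eq_left h3]
      linarith [max_comm a 0, max_comm (-a) 0]
  have hneg : ∫⁻ x, (-f x).toENNReal ∂μ ≤ ENNReal.ofReal (-a) := by
    have : ∀ᵐ x ∂μ, (-f x).toENNReal ≤ ENNReal.ofReal (-a) := by
      filter_upwards [hf] with x hx
      have h1 : (a : EReal) ≤ f x := by
        rw [hx]
        exact le_add_of_nonneg_right
          (mul_nonneg (by exact_mod_cast hb.le) (EReal.coe_ennreal_nonneg _))
      have h2 : -f x ≤ ((-a : ℝ) : EReal) := by
        rw [EReal.coe_neg]
        exact EReal.neg_le_neg_iff.2 h1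
      refine (EReal.toENNReal_le_toENNReal h2).trans ?_
      rw [EReal.real_coe_toENNReal]
    refine (lintegral_mono_ae this).trans ?_
    simp
  have hneg' : ∫⁻ x, (-f x).toENNReal ∂μ ≠ ⊤ := ne_top_of_le_ne_top (by simp) hneg
  have hint := lintegral_congr_ae hpt
  rw [lintegral_add_right _ measurable_const, lintegral_add_right _ (by fun_prop),
    lintegral_add_left measurable_const, lintegral_const_mul _ hg, lintegral_const,
    lintegral_const, measure_univ, mul_one, mul_one] at hint
  rw [eintegral]
  generalize ∫⁻ x, (f x).toENNReal ∂μ = P at *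
  generalize ∫⁻ x, g x ∂μ = G at *
  lift ∫⁻ x, (-f x).toENNReal ∂μ to NNReal using hneg' with N
  induction G using ENNReal.recTopCoe with
  | top =>
    have hP : P = ⊤ := by
      rw [ENNReal.mul_top (by simpa using hb), add_top, add_top, ENNReal.add_eq_top] at hint
      exact hint.resolve_right (by simp)
    rw [hP, EReal.coe_ennreal_top, EReal.coe_mul_top_of_pos hb, EReal.coe_add_top]
    rfl
  | coe G =>
    have hP : P ≠ ⊤ := by
      intro h
      rw [h, top_add, ← ENNReal.ofReal_coe_nnreal (p := G), ← ENNReal.ofReal_mul hb.le] at hint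
      exact ENNReal.add_ne_top.2 ⟨ENNReal.coe_ne_top, ENNReal.add_ne_top.2
        ⟨ENNReal.ofReal_ne_top, ENNReal.ofReal_ne_top⟩⟩ hint.symm
    lift P to NNReal using hP
    rw [← ENNReal.ofReal_coe_nnreal (p := G), ← ENNReal.ofReal_mul hb.le] at hint
    simp only [ENNReal.ofReal] at hint
    norm_cast at hint
    rw [← NNReal.coe_inj] at hint
    push_cast at hint
    have h3 : 0 ≤ b * G := by positivity
    simp only [Real.coe_toNNReal'] at hint
    rw [max_eq_left h3] at hint
    have h1 := max_zero_sub_eq_self a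
    have : ((P : ℝ) - N : ℝ) = a + b * G := by linarith [max_comm a 0, max_comm (-a) 0]
    change (((P : ℝ) : EReal)) - ((N : ℝ) : EReal) = a + b * ((G : ℝ) : EReal)
    rw [← EReal.coe_sub, this]
    push_cast
    rfl

lemma eintegral_eq_integral {μ : Measure X} {f : X → EReal} {g : X → ℝ} (hg : Integrable g μ)
    (hf : ∀ᵐ x ∂μ, f x = (g x : EReal)) : eintegral μ f = ((∫ x, g x ∂μ : ℝ) : EReal) := by
  have h1 : ∫⁻ x, (f x).toENNReal ∂μ = ∫⁻ x, ENNReal.ofReal (g x) ∂μ := by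
    refine lintegral_congr_ae (hf.mono fun x hx ↦ ?_)
    simp only
    rw [hx, EReal.real_coe_toENNReal]
  have h2 : ∫⁻ x, (-f x).toENNReal ∂μ = ∫⁻ x, ENNReal.ofReal (-g x) ∂μ := by
    refine lintegral_congr_ae (hf.mono fun x hx ↦ ?_)
    simp only
    rw [hx, ← EReal.coe_neg, EReal.real_coe_toENNReal]
  have h3 : ∫⁻ x, ENNReal.ofReal (g x) ∂μ ≠ ⊤ := hg.lintegral_lt_top.ne
  have h4 : ∫⁻ x, ENNReal.ofReal (-g x) ∂μ ≠ ⊤ := hg.neg.lintegral_lt_top.ne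
  rw [eintegral, h1, h2, integral_eq_lintegral_pos_part_sub_lintegral_neg_part hg]
  generalize ∫⁻ x, ENNReal.ofReal (g x) ∂μ = P at *
  generalize ∫⁻ x, ENNReal.ofReal (-g x) ∂μ = N at *
  lift P to NNReal using h3
  lift N to NNReal using h4
  rfl

lemma le_eintegral {μ : Measure X} [IsProbabilityMeasure μ] {f : X → EReal} {c : ℝ}
    (hf : ∀ᵐ x ∂μ, (c : EReal) ≤ f x) : (c : EReal) ≤ eintegral μ f := by
  have h := eintegral_eq_integral (μ := μ) (integrable_const c) (ae_of_all _ fun _ ↦ rfl)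
  rw [integral_const, probReal_univ, one_smul] at h
  rw [← h]
  refine EReal.sub_le_sub ?_ ?_
  · refine EReal.coe_ennreal_le_coe_ennreal_iff.2 (lintegral_mono_ae (hf.mono fun x hx ↦ ?_))
    exact EReal.toENNReal_le_toENNReal hx
  · refine EReal.coe_ennreal_le_coe_ennreal_iff.2 (lintegral_mono_ae (hf.mono fun x hx ↦ ?_))
    exact EReal.toENNReal_le_toENNReal (EReal.neg_le_neg_iff.2 hx)

end ExtendedIntegral

/-! ### The equilibrium measures -/

section Equilibrium

variable {d : ℕ}

lemma energy_eq (hd : 2 ≤ d) {ν : Measure (EuclideanSpace ℝ (Fin d))} [IsProbabilityMeasure ν]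
    (hν : ν (closedBall 0 1)ᶜ = 0) :
    energy d ν = (kernelShift d : EReal) +
      (kernelScale d : EReal) * (coulombEnergy ((d : ℝ) / 2) ν ν : EReal) := by
  refine eintegral_affine (by fun_prop) (kernelScale_pos hd) ?_
  filter_upwards [ae_prod_norm_sub_sq_le hν hν] with z hz
  exact kernel_eq hd (norm_nonneg _) hz

/-- Comparison of two weighted energies without subtraction; the normalized energies `e`, `e'` may
be infinite. -/
lemma weightedEnergy_le_iff {a b c : ℝ} (hb : 0 < b) {e e' T T' : ENNReal} (hT : T ≠ ⊤)
    (hT' : T' ≠ ⊤) :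
    ((a : EReal) + (b : EReal) * (e : EReal)) + 2 * ((c - b * T.toReal : ℝ) : EReal) ≤
      ((a : EReal) + (b : EReal) * (e' : EReal)) + 2 * ((c - b * T'.toReal : ℝ) : EReal) ↔
    e + 2 * T' ≤ e' + 2 * T := by
  have h2 : ∀ r : ℝ, (2 : EReal) * (r : EReal) = ((2 * r : ℝ) : EReal) := fun r ↦ by
    push_cast
    rfl
  rw [h2, h2]
  lift T to NNReal using hT
  lift T' to NNReal using hT'
  rw [ENNReal.coe_toReal, ENNReal.coe_toReal]
  have hreal : ∀ (t : NNReal) (r : ℝ), (a : EReal) + (b : EReal) * ((t : ENNReal) : EReal) +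
      (r : EReal) = ((a + b * t + r : ℝ) : EReal) := fun t r ↦ by
    push_cast
    rfl
  have htop : ∀ r : ℝ, (a : EReal) + (b : EReal) * ((⊤ : ENNReal) : EReal) + (r : EReal) = ⊤ := by
    intro r
    rw [EReal.coe_ennreal_top, EReal.coe_mul_top_of_pos hb, EReal.coe_add_top, EReal.top_add_coe]
  induction e' using ENNReal.recTopCoe with
  | top =>
    rw [htop, top_add]
    simp
  | coe e' =>
    induction e using ENNReal.recTopCoe with
    | top =>
      rw [htop, top_add, hreal, top_le_iff, top_le_iff]
      exact iff_of_false (EReal.coe_ne_top _)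
        (ENNReal.add_ne_top.2 ⟨ENNReal.coe_ne_top, ENNReal.mul_ne_top (by simp) ENNReal.coe_ne_top⟩)
    | coe e =>
      rw [hreal, hreal, EReal.coe_le_coe_iff]
      norm_cast
      rw [← NNReal.coe_le_coe]
      push_cast
      constructor
      · intro h
        refine le_of_mul_le_mul_left ?_ hb
        linarith
      · intro h
        have := mul_le_mul_of_nonneg_left h hb.le
        linarith

/-- For `γ ≤ 0`, minus the external field of the charge, normalized to vanish on the unit sphere and
measured in the units of `coulomb`. -/
noncomputable def negField (d : ℕ) (γ h : ℝ) (x : EuclideanSpace ℝ (Fin d)) : ENNReal :=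
  ∫⁻ v in Ioc (‖x‖ ^ 2) 1, ENNReal.ofReal (-γ * (v + h ^ 2) ^ (-((d : ℝ) / 2)))

lemma negField_eq {γ h : ℝ} (hγ : γ ≤ 0) (hh : 0 < h) {x : EuclideanSpace ℝ (Fin d)}
    (hx : ‖x‖ ≤ 1) :
    negField d γ h x = ENNReal.ofReal (-γ * (coulombReal ((d : ℝ) / 2) (‖x‖ ^ 2 + h ^ 2) -
      coulombReal ((d : ℝ) / 2) (1 + h ^ 2))) := by
  have hx2 : ‖x‖ ^ 2 ≤ 1 := pow_le_one₀ (norm_nonneg _) hx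
  have hpos : ∀ v ∈ Icc (‖x‖ ^ 2) 1, 0 < v + h ^ 2 := fun v hv ↦ by
    have : 0 ≤ v := (sq_nonneg _).trans hv.1
    positivity
  have hc : ContinuousOn (fun v : ℝ ↦ -γ * (v + h ^ 2) ^ (-((d : ℝ) / 2))) (Icc (‖x‖ ^ 2) 1) :=
    ContinuousOn.mul (by fun_prop)
      (ContinuousOn.rpow_const (by fun_prop) fun v hv ↦ Or.inl (hpos v hv).ne')
  have h0 : 0 < ‖x‖ ^ 2 + h ^ 2 := by positivity
  have h1 : 0 < 1 + h ^ 2 := by positivity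
  rw [negField, ← ofReal_integral_eq_lintegral_ofReal
    (hc.integrableOn_Icc.mono_set Ioc_subset_Icc_self), ← intervalIntegral.integral_of_le hx2,
    intervalIntegral.integral_const_mul,
    intervalIntegral.integral_comp_add_right (fun u ↦ u ^ (-((d : ℝ) / 2)))]
  · congr 2
    rw [coulombReal, coulombReal, eq_sub_iff_add_eq]
    exact intervalIntegral.integral_add_adjacent_intervals (intervalIntegrable_rpow_neg _ h0 h1)
      (intervalIntegrable_rpow_neg _ h1 (by norm_num))
  · filter_upwards [ae_restrict_mem measurableSet_Ioc] with v hv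
    have := hpos v (Ioc_subset_Icc_self hv)
    have : 0 ≤ -γ := by linarith
    simp only [Pi.zero_apply]
    positivity

lemma negField_le (γ h : ℝ) (x : EuclideanSpace ℝ (Fin d)) :
    negField d γ h x ≤ negField d γ h 0 := by
  refine lintegral_mono_set (Ioc_subset_Ioc_left ?_)
  simp

lemma negField_ne_top {γ h : ℝ} (hγ : γ ≤ 0) (hh : 0 < h) :
    negField d γ h 0 ≠ ⊤ := by
  rw [negField_eq hγ hh (by simp)]
  exact ENNReal.ofReal_ne_top

lemma measurable_negField (γ h : ℝ) : Measurable (negField d γ h) := by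
  have h1 : Antitone fun s : ℝ ↦
      ∫⁻ v in Ioc s 1, ENNReal.ofReal (-γ * (v + h ^ 2) ^ (-((d : ℝ) / 2))) :=
    fun _ _ h ↦ lintegral_mono_set (Ioc_subset_Ioc_left h)
  exact h1.measurable.comp (by fun_prop : Measurable fun x : EuclideanSpace ℝ (Fin d) ↦ ‖x‖ ^ 2)

lemma coulombReal_anti (p : ℝ) {s t : ℝ} (hs : 0 < s) (hst : s ≤ t) :
    coulombReal p t ≤ coulombReal p s := by
  have ht : 0 < t := hs.trans_le hst
  have h := intervalIntegral.integral_add_adjacent_intervals (intervalIntegrable_rpow_neg p hs ht)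
    (intervalIntegrable_rpow_neg p ht (by norm_num : (0 : ℝ) < 4))
  have h0 : 0 ≤ ∫ v in s..t, v ^ (-p) := intervalIntegral.integral_nonneg hst fun v hv ↦ by
    have : 0 < v := hs.trans_le hv.1
    positivity
  rw [coulombReal, coulombReal]
  linarith

lemma eintegral_externalField (hd : 2 ≤ d) {γ h : ℝ} (hγ : γ ≤ 0) (hh : 0 < h)
    {ν : Measure (EuclideanSpace ℝ (Fin d))} [IsProbabilityMeasure ν]
    (hν : ν (closedBall 0 1)ᶜ = 0) :
    eintegral ν (externalField d γ h) =
      ((γ * (kernelShift d + kernelScale d * coulombReal ((d : ℝ) / 2) (1 + h ^ 2)) -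
        kernelScale d * (∫⁻ x, negField d γ h x ∂ν).toReal : ℝ) : EReal) := by
  have hfin := lintegral_ne_top_of_le (negField_ne_top hγ hh) (negField_le γ h) ν
  have hint : Integrable (fun x ↦ (negField d γ h x).toReal) ν :=
    integrable_toReal_of_lintegral_ne_top (measurable_negField γ h).aemeasurable hfin
  have hν' : ∀ᵐ x ∂ν, x ∈ closedBall (0 : EuclideanSpace ℝ (Fin d)) 1 := hν
  rw [eintegral_eq_integral (g := fun x ↦
      γ * (kernelShift d + kernelScale d * coulombReal ((d : ℝ) / 2) (1 + h ^ 2)) -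
        kernelScale d * (negField d γ h x).toReal)
      ((integrable_const _).sub (hint.const_mul _)),
    integral_sub (integrable_const _) (hint.const_mul _), integral_const,
    probReal_univ, one_smul, integral_const_mul, integral_toReal
      (measurable_negField γ h).aemeasurable
      (Filter.Eventually.of_forall fun x ↦
        ((negField_le γ h x).trans_lt (negField_ne_top hγ hh).lt_top))]
  filter_upwards [hν'] with x hx
  rw [mem_closedBall_zero_iff] at hx
  have h0 : 0 < ‖x‖ ^ 2 + h ^ 2 := by positivity
  have hx2 : ‖x‖ ^ 2 ≤ 1 := pow_le_one₀ (norm_nonneg _) hx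
  have h1 := coulombReal_anti ((d : ℝ) / 2) h0 (by linarith : ‖x‖ ^ 2 + h ^ 2 ≤ 1 + h ^ 2)
  rw [externalField_eq hd γ h h0, negField_eq hγ hh hx, ENNReal.toReal_ofReal
    (mul_nonneg (by linarith) (by linarith))]
  congr 1
  ring

lemma radialMass_mono {γ h : ℝ} (hγ : γ ≤ 0) (hh : 0 < h) {s t : ℝ} (hs : 0 ≤ s) (hst : s ≤ t) :
    radialMass d γ h s ≤ radialMass d γ h t := by
  have ht : 0 ≤ t := hs.trans hst
  refine mul_le_mul_of_nonneg_left (Real.rpow_le_rpow (by positivity) ?_ (by positivity))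
    (by linarith)
  rw [div_le_div_iff₀ (by positivity) (by positivity)]
  nlinarith [mul_le_mul_of_nonneg_right hst (sq_nonneg h)]

lemma radialMass_nonneg {γ h : ℝ} (hγ : γ ≤ 0) {s : ℝ} (hs : 0 ≤ s) :
    0 ≤ radialMass d γ h s := by
  have : 0 ≤ -γ := by linarith
  unfold radialMass
  positivity

/-- The identity behind the choice of `τ`: the field of the mass inside cancels that of the
charge. -/
lemma rpow_neg_mul_radialMass (d : ℕ) (γ h : ℝ) {v : ℝ} (hv : 0 < v) :
    v ^ (-((d : ℝ) / 2)) * radialMass d γ h v = -γ * (v + h ^ 2) ^ (-((d : ℝ) / 2)) := by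
  have h1 : 0 < v + h ^ 2 := by positivity
  rw [radialMass, Real.div_rpow hv.le h1.le, Real.rpow_neg hv.le, Real.rpow_neg h1.le]
  have : v ^ ((d : ℝ) / 2) ≠ 0 := by positivity
  field_simp

/-- The part of the field that `τ` leaves unbalanced at squared distance `s` from the origin: beyond
the radius `R` the mass of `τ` stays constant, while balancing the field would require `radialMass`
to keep growing. It is constant for `0 ≤ s ≤ R ^ 2`, which is why the total potential
is constant on the ball of radius `R`. -/
noncomputable def massDefect (d : ℕ) (γ h s : ℝ) : ENNReal :=
  ∫⁻ v in Ioc s 1, ENNReal.ofReal (v ^ (-((d : ℝ) / 2))) *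
    ENNReal.ofReal (radialMass d γ h v - radialMass d γ h (min v (radius d γ h ^ 2)))

lemma massDefect_anti (d : ℕ) (γ h : ℝ) : Antitone (massDefect d γ h) := fun _ _ h ↦
  lintegral_mono_set (Ioc_subset_Ioc_left h)

lemma massDefect_eq {γ h s : ℝ} (hs0 : 0 ≤ s) (hs : s ≤ radius d γ h ^ 2)
    (hR : radius d γ h ^ 2 ≤ 1) : massDefect d γ h s = massDefect d γ h 0 := by
  have h0 : ∫⁻ v in Ioc 0 s, ENNReal.ofReal (v ^ (-((d : ℝ) / 2))) *
      ENNReal.ofReal (radialMass d γ h v - radialMass d γ h (min v (radius d γ h ^ 2))) = 0 := by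
    refine (setLIntegral_congr_fun measurableSet_Ioc fun v hv ↦ ?_).trans lintegral_zero
    rw [min_eq_left (hv.2.trans hs), sub_self, ENNReal.ofReal_zero, mul_zero]
  rw [massDefect, massDefect, ← Ioc_union_Ioc_eq_Ioc hs0 (hs.trans hR),
    lintegral_union measurableSet_Ioc (Ioc_disjoint_Ioc_of_le le_rfl), h0, zero_add]

lemma lintegral_add_massDefect {γ h : ℝ} (hγ : γ ≤ 0) (hh : 0 < h)
    (x : EuclideanSpace ℝ (Fin d)) :
    (∫⁻ v in Ioc (‖x‖ ^ 2) 1, ENNReal.ofReal (v ^ (-((d : ℝ) / 2))) *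
        ENNReal.ofReal (radialMass d γ h (min v (radius d γ h ^ 2)))) +
      massDefect d γ h (‖x‖ ^ 2) = negField d γ h x := by
  rw [massDefect, negField, ← lintegral_add_left (by fun_prop)]
  refine setLIntegral_congr_fun measurableSet_Ioc fun v hv ↦ ?_
  have hv0 : 0 < v := lt_of_le_of_lt (by positivity) hv.1
  have hm : 0 ≤ min v (radius d γ h ^ 2) := le_min hv0.le (sq_nonneg _)
  have h1 := radialMass_mono (d := d) hγ hh hm (min_le_left _ _)
  rw [← mul_add, ← ENNReal.ofReal_add (radialMass_nonneg hγ hm) (by linarith), add_sub_cancel,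
    ← ENNReal.ofReal_mul (by positivity), rpow_neg_mul_radialMass d γ h hv0]

lemma lintegral_coulomb_sigma (hd : 2 ≤ d) {x : EuclideanSpace ℝ (Fin d)} (hx : ‖x‖ ≤ 1) :
    ∫⁻ y, coulomb ((d : ℝ) / 2) (‖x - y‖ ^ 2) ∂(sigma d) = coulomb ((d : ℝ) / 2) 1 := by
  rw [lintegral_sigma (g := fun y ↦ coulomb ((d : ℝ) / 2) (‖x - y‖ ^ 2)) (by fun_prop)]
  have := lintegral_coulomb_sphere hd hx zero_le_one le_rfl
  simpa [max_eq_right hx] using this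

lemma coulomb_one_ne_top (p : ℝ) : coulomb p 1 ≠ ⊤ := by
  rw [coulomb_eq_ofReal p one_pos]
  exact ENNReal.ofReal_ne_top

/-- The potential of `τ + c σ`, up to the defect, is the negated external field up to a constant. -/
lemma lintegral_coulomb_tau_add_sigma (hd : 2 ≤ d) {γ h : ℝ} (hγ : γ ≤ 0) (hh : 0 < h)
    (hR : 0 ≤ radius d γ h) (hR1 : radius d γ h ≤ 1) {c : ENNReal}
    (hmass : ENNReal.ofReal (radialMass d γ h (radius d γ h ^ 2)) + c = 1)
    {x : EuclideanSpace ℝ (Fin d)} (hx : ‖x‖ ≤ 1) :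
    ∫⁻ y, coulomb ((d : ℝ) / 2) (‖x - y‖ ^ 2) ∂(tau d γ h + c • sigma d) +
      massDefect d γ h (‖x‖ ^ 2) = coulomb ((d : ℝ) / 2) 1 + negField d γ h x := by
  have hx2 : ‖x‖ ^ 2 ≤ 1 := pow_le_one₀ (norm_nonneg _) hx
  have hR2 : radius d γ h ^ 2 ≤ 1 := pow_le_one₀ hR hR1
  have houter : ∫⁻ v in Ioc 1 4, ENNReal.ofReal (v ^ (-((d : ℝ) / 2))) *
        ENNReal.ofReal (radialMass d γ h (min v (radius d γ h ^ 2))) =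
      coulomb ((d : ℝ) / 2) 1 * ENNReal.ofReal (radialMass d γ h (radius d γ h ^ 2)) := by
    rw [coulomb, ← lintegral_mul_const _ (by fun_prop)]
    refine setLIntegral_congr_fun measurableSet_Ioc fun v hv ↦ ?_
    rw [min_eq_right (hR2.trans hv.1.le)]
  rw [lintegral_add_measure, lintegral_smul_measure, lintegral_coulomb_sigma hd hx,
    lintegral_coulomb_tau hd hγ hh hR hR1 hx,
    ← Ioc_union_Ioc_eq_Ioc hx2 (by norm_num : (1 : ℝ) ≤ 4),
    lintegral_union measurableSet_Ioc (Ioc_disjoint_Ioc_of_le le_rfl), houter,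
    ← lintegral_add_massDefect hγ hh x, smul_eq_mul]
  calc _ = coulomb ((d : ℝ) / 2) 1 *
          (ENNReal.ofReal (radialMass d γ h (radius d γ h ^ 2)) + c) +
        ((∫⁻ v in Ioc (‖x‖ ^ 2) 1, ENNReal.ofReal (v ^ (-((d : ℝ) / 2))) *
          ENNReal.ofReal (radialMass d γ h (min v (radius d γ h ^ 2)))) +
        massDefect d γ h (‖x‖ ^ 2)) := by ring
    _ = _ := by rw [hmass, mul_one]

lemma isProbabilityMeasure_sigma (hd : 2 ≤ d) : IsProbabilityMeasure (sigma d) := by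
  have := isProbabilityMeasure_sphereProb hd
  exact Measure.isProbabilityMeasure_map measurable_subtype_coe.aemeasurable

lemma measure_compl_closedBall_eq_zero {μ : Measure (EuclideanSpace ℝ (Fin d))}
    (h : ∀ᵐ x ∂μ, ‖x‖ ≤ 1) : μ (closedBall 0 1)ᶜ = 0 := by
  have h1 : ∀ᵐ x ∂μ, x ∈ closedBall (0 : EuclideanSpace ℝ (Fin d)) 1 := by
    simpa only [mem_closedBall_zero_iff] using h
  exact h1

/-- The equilibrium problem for an attracting charge `γ ≤ 0`, for both possible shapes of the
solution: either `τ` alone has mass one, or `R = 1` and the missing mass `c` sits on the sphere. -/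
theorem isEquilibriumMeasure_iff_of_nonpos (hd : 2 ≤ d) {γ h : ℝ} (hγ : γ ≤ 0) (hh : 0 < h)
    (hR : 0 ≤ radius d γ h) (hR1 : radius d γ h ≤ 1) {c : ENNReal}
    (hmass : ENNReal.ofReal (radialMass d γ h (radius d γ h ^ 2)) + c = 1)
    (hc : c = 0 ∨ radius d γ h = 1) (ν : Measure (EuclideanSpace ℝ (Fin d))) :
    IsEquilibriumMeasure d (closedBall 0 1) (externalField d γ h) ν ↔
      ν = tau d γ h + c • sigma d := by
  have hd' : (2 : ℝ) ≤ d := by exact_mod_cast hd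
  have := isProbabilityMeasure_sigma hd
  set μ := tau d γ h + c • sigma d with hμdef
  have hμp : IsProbabilityMeasure μ := by
    refine ⟨?_⟩
    rw [hμdef, Measure.add_apply, Measure.smul_apply, measure_univ (μ := sigma d), smul_eq_mul,
      mul_one, tau_univ hd hγ hh hR, hmass]
  have hμR : ∀ᵐ x ∂μ, ‖x‖ ≤ radius d γ h := by
    refine ae_add_measure_iff.2 ⟨ae_tau_norm_le hd γ h, ?_⟩
    rcases hc with hc | hc
    · simp [hc]
    · refine Measure.ae_smul_measure ?_ c
      filter_upwards [ae_sigma_norm_eq d] with x hx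
      rw [hx, hc]
  have hμ : μ (closedBall 0 1)ᶜ = 0 :=
    measure_compl_closedBall_eq_zero (hμR.mono fun x hx ↦ hx.trans hR1)
  have hR2 : radius d γ h ^ 2 ≤ 1 := pow_le_one₀ hR hR1
  have hpot : ∀ x : EuclideanSpace ℝ (Fin d), ‖x‖ ≤ 1 → _ := fun x hx ↦
    lintegral_coulomb_tau_add_sigma hd hγ hh hR hR1 hmass hx
  have hdef : massDefect d γ h 0 ≠ ⊤ := by
    refine ne_top_of_le_ne_top (negField_ne_top (d := d) hγ hh) ?_
    rw [← lintegral_add_massDefect hγ hh]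
    simp
  have hfrost : ∀ ν : Measure (EuclideanSpace ℝ (Fin d)), IsProbabilityMeasure ν →
      ν (closedBall 0 1)ᶜ = 0 → _ := fun ν _ hν ↦
    frostman (p := (d : ℝ) / 2) (by linarith) hμ hν (negField_ne_top (d := d) hγ hh)
      (negField_le γ h) (coulomb_one_ne_top _) hdef
      (by
        intro x hx
        rw [mem_closedBall_zero_iff] at hx
        rw [← hpot x hx]
        gcongr
        exact massDefect_anti _ _ _ (sq_nonneg _))
      (by
        filter_upwards [hμR] with x hx
        rw [← hpot x (hx.trans hR1),
          massDefect_eq (sq_nonneg _) (pow_le_pow_left₀ (norm_nonneg _) hx 2) hR2])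
  have hle : ∀ ν₁ ν₂ : Measure (EuclideanSpace ℝ (Fin d)), IsProbabilityMeasure ν₁ →
      IsProbabilityMeasure ν₂ → ν₁ (closedBall 0 1)ᶜ = 0 → ν₂ (closedBall 0 1)ᶜ = 0 →
      (weightedEnergy d (externalField d γ h) ν₁ ≤ weightedEnergy d (externalField d γ h) ν₂ ↔
        coulombEnergy ((d : ℝ) / 2) ν₁ ν₁ + 2 * ∫⁻ x, negField d γ h x ∂ν₂ ≤
          coulombEnergy ((d : ℝ) / 2) ν₂ ν₂ + 2 * ∫⁻ x, negField d γ h x ∂ν₁) := by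
    intro ν₁ ν₂ _ _ h₁ h₂
    rw [weightedEnergy, weightedEnergy, energy_eq hd h₁, energy_eq hd h₂,
      eintegral_externalField hd hγ hh h₁, eintegral_externalField hd hγ hh h₂]
    exact weightedEnergy_le_iff (kernelScale_pos hd)
      (lintegral_ne_top_of_le (negField_ne_top hγ hh) (negField_le γ h) _)
      (lintegral_ne_top_of_le (negField_ne_top hγ hh) (negField_le γ h) _)
  constructor
  · rintro ⟨hνp, hν, hmin⟩
    exact (hfrost ν hνp hν).2 ((hle _ _ hνp hμp hν hμ).1 (hmin μ hμp hμ))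
  · rintro rfl
    exact ⟨hμp, hμ, fun ν hνp hν ↦ (hle _ _ hμp hνp hμ hν).2 (hfrost ν hνp hν).1⟩

/-- For a repelling charge the sphere minimizes both the energy and the external field. -/
theorem isEquilibriumMeasure_iff_of_nonneg (hd : 2 ≤ d) {γ h : ℝ} (hγ : 0 ≤ γ)
    (ν : Measure (EuclideanSpace ℝ (Fin d))) :
    IsEquilibriumMeasure d (closedBall 0 1) (externalField d γ h) ν ↔ ν = sigma d := by
  have hd' : (2 : ℝ) ≤ d := by exact_mod_cast hd
  have hσp := isProbabilityMeasure_sigma hd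
  have hσ : sigma d (closedBall 0 1)ᶜ = 0 :=
    measure_compl_closedBall_eq_zero ((ae_sigma_norm_eq d).mono fun x hx ↦ hx.le)
  have hfrost : ∀ ν : Measure (EuclideanSpace ℝ (Fin d)), IsProbabilityMeasure ν →
      ν (closedBall 0 1)ᶜ = 0 → _ := fun ν _ hν ↦
    frostman (p := (d : ℝ) / 2) (by linarith) hσ hν (W := fun _ ↦ 0) (B := 0) (D := 0)
      ENNReal.zero_ne_top (fun _ ↦ le_rfl) (coulomb_one_ne_top _) ENNReal.zero_ne_top
      (by
        intro x hx
        rw [mem_closedBall_zero_iff] at hx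
        rw [lintegral_coulomb_sigma hd hx])
      (by
        filter_upwards [ae_sigma_norm_eq d] with x hx
        rw [lintegral_coulomb_sigma hd hx.le])
  simp only [lintegral_zero, mul_zero, add_zero] at hfrost
  set q : ℝ := γ * (kernelShift d + kernelScale d * coulombReal ((d : ℝ) / 2) (1 + h ^ 2)) with hq
  have hQσ : eintegral (sigma d) (externalField d γ h) = (q : EReal) := by
    rw [eintegral_eq_integral (g := fun _ ↦ q) (integrable_const _)]
    · simp
    · filter_upwards [ae_sigma_norm_eq d] with x hx
      rw [externalField_eq hd γ h (by rw [hx]; positivity), hx, one_pow]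
  have hQ : ∀ ν : Measure (EuclideanSpace ℝ (Fin d)), IsProbabilityMeasure ν →
      ν (closedBall 0 1)ᶜ = 0 → (q : EReal) ≤ eintegral ν (externalField d γ h) := by
    intro ν _ hν
    have hν' : ∀ᵐ x ∂ν, x ∈ closedBall (0 : EuclideanSpace ℝ (Fin d)) 1 := hν
    refine le_eintegral (hν'.mono fun x hx ↦ ?_)
    rw [mem_closedBall_zero_iff] at hx
    have hx2 : ‖x‖ ^ 2 ≤ 1 := pow_le_one₀ (norm_nonneg _) hx
    rcases (by positivity : 0 ≤ ‖x‖ ^ 2 + h ^ 2).eq_or_lt with h0 | h0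
    · rw [externalField, if_pos h0.symm]
      rcases hγ.eq_or_lt with h1 | h1
      · simp [hq, ← h1]
      · rw [EReal.coe_mul_top_of_pos h1]
        exact le_top
    · rw [externalField_eq hd γ h h0, EReal.coe_le_coe_iff]
      have h1 := coulombReal_anti ((d : ℝ) / 2) h0 (by linarith : ‖x‖ ^ 2 + h ^ 2 ≤ 1 + h ^ 2)
      have h2 := mul_le_mul_of_nonneg_left h1 (kernelScale_pos hd).le
      exact mul_le_mul_of_nonneg_left (by linarith) hγ
  -- Comparison of `I(ν) + 2 Q(1)`, a lower bound of the weighted energy that is exact for `σ`.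
  have hle : ∀ e e' : ENNReal,
      ((kernelShift d : EReal) + (kernelScale d : EReal) * (e : EReal)) + 2 * (q : EReal) ≤
      ((kernelShift d : EReal) + (kernelScale d : EReal) * (e' : EReal)) + 2 * (q : EReal) ↔
      e ≤ e' := by
    intro e e'
    have := weightedEnergy_le_iff (a := kernelShift d) (c := q) (kernelScale_pos hd) (e := e)
      (e' := e') ENNReal.zero_ne_top ENNReal.zero_ne_top
    simpa using this
  have hlow : ∀ ν : Measure (EuclideanSpace ℝ (Fin d)), IsProbabilityMeasure ν →
      ν (closedBall 0 1)ᶜ = 0 →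
      ((kernelShift d : EReal) + (kernelScale d : EReal) *
        (coulombEnergy ((d : ℝ) / 2) ν ν : EReal)) + 2 * (q : EReal) ≤
      weightedEnergy d (externalField d γ h) ν := by
    intro ν hνp hν
    rw [weightedEnergy, energy_eq hd hν]
    gcongr
    exact hQ ν hνp hν
  have hσe : weightedEnergy d (externalField d γ h) (sigma d) =
      ((kernelShift d : EReal) + (kernelScale d : EReal) *
        (coulombEnergy ((d : ℝ) / 2) (sigma d) (sigma d) : EReal)) + 2 * (q : EReal) := by
    rw [weightedEnergy, energy_eq hd hσ, hQσ]
  constructor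
  · rintro ⟨hνp, hν, hmin⟩
    refine (hfrost ν hνp hν).2 ((hle _ _).1 ?_)
    exact (hlow ν hνp hν).trans ((hmin _ hσp hσ).trans hσe.le)
  · rintro rfl
    refine ⟨hσp, hσ, fun ν hνp hν ↦ ?_⟩
    rw [hσe]
    exact ((hle _ _).2 (hfrost ν hνp hν).1).trans (hlow ν hνp hν)

end Equilibrium

/-! ### The radius at which `τ` reaches mass one -/

section Radius

variable {d : ℕ}

lemma radialMass_one (γ h : ℝ) : radialMass d γ h 1 = γ / gammaTilde d h := by
  have h1 : 0 < 1 + h ^ 2 := by positivity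
  rw [radialMass, gammaTilde, Real.div_rpow zero_le_one h1.le, Real.one_rpow, div_neg]
  ring

lemma gammaTilde_neg (d : ℕ) (h : ℝ) : gammaTilde d h < 0 := by
  unfold gammaTilde
  have : 0 < (1 + h ^ 2) ^ ((d : ℝ) / 2) := by positivity
  linarith

/-- For `γ < γ̃` the radius `R₀` is less than one and is the radius at which `τ` reaches mass
one. -/
lemma radiusZero_spec (hd : 2 ≤ d) {γ h : ℝ} (hh : 0 < h) (hγ : γ < gammaTilde d h) :
    0 ≤ radiusZero d γ h ∧ radiusZero d γ h ≤ 1 ∧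
      radialMass d γ h (radiusZero d γ h ^ 2) = 1 := by
  have hd0 : (0 : ℝ) < d := by exact_mod_cast (by omega : 0 < d)
  have hγ0 : γ < 0 := hγ.trans (gammaTilde_neg d h)
  set k := |γ| ^ (2 / (d : ℝ)) with hk
  have habs : |γ| = -γ := abs_of_neg hγ0
  have hγpos : 0 < |γ| := abs_pos.2 hγ0.ne
  have hkγ : k ^ ((d : ℝ) / 2) = |γ| := by
    rw [hk, ← Real.rpow_mul hγpos.le]
    have : 2 / (d : ℝ) * (d / 2) = 1 := by field_simp
    rw [this, Real.rpow_one]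
  have hk1 : 1 + h ^ 2 < k := by
    rw [← Real.rpow_lt_rpow_iff (z := (d : ℝ) / 2) (by positivity) (by positivity) (by positivity),
      hkγ, habs]
    unfold gammaTilde at hγ
    linarith
  have hkh : h ^ 2 < k - 1 := by linarith
  have hk0 : 0 < k - 1 := (sq_nonneg h).trans_lt hkh
  have hR2 : radiusZero d γ h ^ 2 = h ^ 2 / (k - 1) := by
    rw [radiusZero, div_pow, Real.sq_sqrt hk0.le]
  have hR0 : 0 ≤ radiusZero d γ h := div_nonneg hh.le (Real.sqrt_nonneg _)
  refine ⟨hR0, ?_, ?_⟩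
  · rw [← pow_le_one_iff_of_nonneg hR0 two_ne_zero, hR2, div_le_one hk0]
    exact hkh.le
  · have h1 : h ^ 2 / (k - 1) / (h ^ 2 / (k - 1) + h ^ 2) = 1 / k := by
      have : k ≠ 0 := by linarith [sq_nonneg h]
      have : h ^ 2 / (k - 1) + h ^ 2 = h ^ 2 * k / (k - 1) := by
        field_simp
        ring
      rw [this]
      field_simp
    rw [radialMass, hR2, h1, Real.div_rpow zero_le_one (by positivity), Real.one_rpow, hkγ, habs]
    exact mul_one_div_cancel (by linarith)

end Radius

end CoulombBall

theorem mainTheorem6 (d : ℕ) (hd : 2 ≤ d) (γ h : ℝ) :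
    (0 < h → γ ≤ CoulombBall.gammaTilde d h →
      CoulombBall.radius d γ h ≤ 1 ∧
      ∀ μ : Measure (EuclideanSpace ℝ (Fin d)),
        CoulombBall.IsEquilibriumMeasure d (closedBall 0 1)
            (CoulombBall.externalField d γ h) μ ↔
          μ = CoulombBall.tau d γ h) ∧
    (0 < h → CoulombBall.gammaTilde d h < γ → γ < 0 →
      CoulombBall.radius d γ h = 1 ∧
      ∀ μ : Measure (EuclideanSpace ℝ (Fin d)),
        CoulombBall.IsEquilibriumMeasure d (closedBall 0 1)
            (CoulombBall.externalField d γ h) μ ↔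
          μ = CoulombBall.tau d γ h +
            ENNReal.ofReal (1 - γ / CoulombBall.gammaTilde d h) • CoulombBall.sigma d) ∧
    (0 ≤ h → 0 ≤ γ →
      ∀ μ : Measure (EuclideanSpace ℝ (Fin d)),
        CoulombBall.IsEquilibriumMeasure d (closedBall 0 1)
            (CoulombBall.externalField d γ h) μ ↔
          μ = CoulombBall.sigma d) := by
  have hneg := CoulombBall.gammaTilde_neg d h
  refine ⟨fun hh hγ ↦ ?_, fun hh hγ hγ0 ↦ ?_, fun _ hγ μ ↦
    CoulombBall.isEquilibriumMeasure_iff_of_nonneg hd hγ μ⟩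
  · have hspec : 0 ≤ CoulombBall.radius d γ h ∧ CoulombBall.radius d γ h ≤ 1 ∧
        CoulombBall.radialMass d γ h (CoulombBall.radius d γ h ^ 2) = 1 := by
      rcases hγ.lt_or_eq with h1 | h1
      · rw [CoulombBall.radius, if_pos h1]
        exact CoulombBall.radiusZero_spec hd hh h1
      · rw [CoulombBall.radius, if_neg h1.not_lt, one_pow, CoulombBall.radialMass_one, h1,
          div_self hneg.ne]
        exact ⟨zero_le_one, le_rfl, rfl⟩
    obtain ⟨hR0, hR1, hm⟩ := hspec
    refine ⟨hR1, fun μ ↦ ?_⟩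
    have := CoulombBall.isEquilibriumMeasure_iff_of_nonpos hd (hγ.trans hneg.le) hh hR0 hR1
      (c := 0) (by rw [hm, ENNReal.ofReal_one, add_zero]) (Or.inl rfl) μ
    rwa [zero_smul, add_zero] at this
  · have hR : CoulombBall.radius d γ h = 1 := by
      rw [CoulombBall.radius, if_neg hγ.not_gt]
    have hle : γ / CoulombBall.gammaTilde d h ≤ 1 := by
      rw [div_le_one_of_neg hneg]
      exact hγ.le
    refine ⟨hR, fun μ ↦ CoulombBall.isEquilibriumMeasure_iff_of_nonpos hd hγ0.le hh
      (by rw [hR]; exact zero_le_one) hR.le ?_ (Or.inr hR) μ⟩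
    rw [hR, one_pow, CoulombBall.radialMass_one, ← ENNReal.ofReal_add
      (div_nonneg_of_nonpos hγ0.le hneg.le) (by linarith), add_sub_cancel, ENNReal.ofReal_one]
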